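/- Let $\mathbb{D}$ be the open unit disc, let $\sigma$ be area measure on $\mathbb{D}$ normalized so that $\sigma(\mathbb{D})=1$, and for $1<p<\infty$ let $A^p$ be the Bergman space of analytic functions $f$ in $\mathbb{D}$ with $\|f\|_{A^p}=\left(\int_{\mathbb{D}}|f|^p\,d\sigma\right)^{1/p}<\infty$. Let $z_1,\dots,z_N$ be distinct points of $\mathbb{D}$ and let $d_1,\dots,d_N$ be positive integers. Let $m$ be the multiplicity of the origin, that is, $m=d_n$ if $z_n=0$ for some $n$, and $m=0$ if no $z_n$ is $0$. The canonical divisor $G$ in $A^p$ for the zero set consisting of the points $z_n$ with multiplicities $d_n$ is the function $G\in A^p$ with $\|G\|_{A^p}=1$ that vanishes at each $z_n$ to order at least $d_n$ and for which $G^{(m)}(0)$ is positive and as large as possible among all such functions. Theorem. Let $p$ be a positive even integer and let $G$ be the canonical divisor in $A^p$ for this zero set. (i) If $z_n\neq 0$ for all $n$, then there are complex constants $c_0$ and $c_{nj}$ such that for all $z\in\mathbb{D}$ $$G(z)^{p/2}=c_0+\sum_{n=1}^N\sum_{j=0}^{(p/2)d_n-1}\frac{c_{nj}}{(1-\overline{z_n}z)^{j+2}}.$$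 (ii) If one of the points is $0$, numbered so that $z_1=0$, then there are complex constants $c_0$ and $c_{nj}$ such that for all $z\in\mathbb{D}$ $$G(z)^{p/2}=c_0z^{(p/2)d_1}+\sum_{j=0}^{(p/2)d_1-1}c_{1j}z^j+\sum_{n=2}^N\sum_{j=0}^{(p/2)d_n-1}\frac{c_{nj}}{(1-\overline{z_n}z)^{j+2}}.$$ (iii) In particular, $G^{p/2}$ coincides on $\mathbb{D}$ with a rational function that has no poles in $\mathbb{D}$ and whose residue at each of its poles in $\mathbb{C}$ is $0$. -/

import Mathlib

open MeasureTheory Filter Topology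
open scoped ENNReal

noncomputable section

namespace Bergman

/-- Area measure on the open unit disc of the complex plane, normalized to total mass one. -/
def area : Measure ℂ :=
  (volume (Metric.ball (0 : ℂ) 1))⁻¹ • volume.restrict (Metric.ball (0 : ℂ) 1)

/-- `f` belongs to the Bergman space `A^p` of the unit disc. Only the values of `f` in the
disc matter; the norm of `f` is `eLpNorm f p area`. -/
def MemBergman (p : ℝ≥0∞) (f : ℂ → ℂ) : Prop :=
  DifferentiableOn ℂ f (Metric.ball 0 1) ∧ MemLp f p area

/-- `f` belongs to the space `N^p` of those functions in `A^p` that vanish at each point `z n`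
to order at least `d n`. -/
def MemVanishing (p : ℝ≥0∞) {N : ℕ} (z : Fin N → ℂ) (d : Fin N → ℕ) (f : ℂ → ℂ) : Prop :=
  MemBergman p f ∧ ∀ n, (d n : ℕ∞) ≤ analyticOrderAt f (z n)

/-- The multiplicity of the origin in the zero set given by the distinct points `z n` with
multiplicities `d n`; it is `0` when the origin is not one of the points. -/
def multAtZero {N : ℕ} (z : Fin N → ℂ) (d : Fin N → ℕ) : ℕ :=
  ∑ n, if z n = 0 then d n else 0

/-- The values allowed in the extremal problem: `x` is a positive real number and `H` is a
function in `N^p` of norm one with `H^(m)(0) = x`, where `m` is the multiplicity of the origin. -/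
def IsAdmissible (p : ℝ≥0∞) {N : ℕ} (z : Fin N → ℂ) (d : Fin N → ℕ) (H : ℂ → ℂ) (x : ℝ) : Prop :=
  MemVanishing p z d H ∧ eLpNorm H p area = 1 ∧ 0 < x ∧
    iteratedDeriv (multAtZero z d) H 0 = (x : ℂ)

/-- `G` is the canonical divisor in `A^p` of the zero set: it has norm one, lies in `N^p`, and
`G^(m)(0)` is positive and as large as possible. -/
def IsCanonicalDivisor (p : ℝ≥0∞) {N : ℕ} (z : Fin N → ℂ) (d : Fin N → ℕ) (G : ℂ → ℂ) : Prop :=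
  ∃ x : ℝ, IsAdmissible p z d G x ∧ ∀ (H : ℂ → ℂ) (y : ℝ), IsAdmissible p z d H y → y ≤ x

/-- `f` has residue `a` at the point `w`: the normalized integrals over all sufficiently small
circles about `w` are equal to `a`. -/
def HasResidue (f : ℂ → ℂ) (w a : ℂ) : Prop :=
  ∀ᶠ r in 𝓝[>] (0 : ℝ), (2 * (Real.pi : ℂ) * Complex.I)⁻¹ * (∮ ζ in C(w, r), f ζ) = a

end Bergman

end

noncomputable section

namespace Bergman

open Metric Complex ComplexConjugate

/-! Write p = 2s. The power G^s is a unit vector of A² with zeros of order s·d_n at z_n, so it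
competes in a linear, hence Hilbert space, extremal problem. Let M be the multiplicity of the origin
for the orders s·d_n. On the space with these zeros, the M-th Taylor coefficient at 0 is
represented, up to the factor M + 1, by Φ, the component of ζ^M orthogonal to finitely many kernels
that reproduce derivatives at the z_n (`exists_extremal`). Thus Φ is explicit: a monomial minus a
combination of kernels.

It remains to see that G^s = Φ/‖Φ‖. The crux is `ne_zero_of_extremal`: Φ has no zeros in the disc
beyond the prescribed ones. An extra zero w could be divided out by the one-point A² divisor at w,
which expands norms (`integral_norm_sq_le_of_mul`), and the quotient would violate Cauchy–Schwarz.
Hence Φ/‖Φ‖ is the s-th power of an admissible H. Comparing G with H bounds the pairing of G^s and Φ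
below by ‖Φ‖, Cauchy–Schwarz bounds it above by ‖Φ‖, and the equality case identifies the functions
(`IsCanonicalDivisor.pow_eq`).

A kernel at w ≠ 0 expands in powers of 1/(1 - w̄ζ) with exponents at least 2, while kernels at 0 are
monomials. Each term then has a rational primitive, so all residues vanish. -/

/-! ### Normalized area measure. -/

instance isProbabilityMeasure_area : IsProbabilityMeasure area := by
  refine ⟨?_⟩
  have h0 : volume (ball (0 : ℂ) 1) ≠ 0 := (measure_ball_pos volume 0 one_pos).ne'
  have h1 : volume (ball (0 : ℂ) 1) ≠ ∞ := measure_ball_lt_top.ne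
  rw [area, Measure.smul_apply, Measure.restrict_apply_univ, smul_eq_mul,
    ENNReal.inv_mul_cancel h0 h1]

lemma ae_area_iff {P : ℂ → Prop} :
    (∀ᵐ z ∂area, P z) ↔ ∀ᵐ z ∂volume.restrict (ball (0 : ℂ) 1), P z := by
  have h1 : (volume (ball (0 : ℂ) 1))⁻¹ ≠ 0 := ENNReal.inv_ne_zero.2 measure_ball_lt_top.ne
  simp only [area, ae_iff, Measure.smul_apply, smul_eq_mul, mul_eq_zero, h1, false_or]

lemma ae_area_of_forall_mem {P : ℂ → Prop} (h : ∀ z ∈ ball (0 : ℂ) 1, P z) : ∀ᵐ z ∂area, P z :=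
  ae_area_iff.2 (ae_restrict_of_forall_mem measurableSet_ball h)

lemma integral_area (f : ℂ → ℂ) :
    ∫ z, f z ∂area = (Real.pi : ℂ)⁻¹ * ∫ z in ball (0 : ℂ) 1, f z := by
  rw [area, integral_smul_measure, ENNReal.toReal_inv, Complex.volume_ball]
  simp [Complex.real_smul]

lemma integrable_area_iff {f : ℂ → ℂ} :
    Integrable f area ↔ IntegrableOn f (ball (0 : ℂ) 1) := by
  have h0 : volume (ball (0 : ℂ) 1) ≠ 0 := (measure_ball_pos volume 0 one_pos).ne'
  have h1 : volume (ball (0 : ℂ) 1) ≠ ∞ := measure_ball_lt_top.ne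
  rw [area, integrable_smul_measure (ENNReal.inv_ne_zero.2 h1) (ENNReal.inv_ne_top.2 h0)]
  rfl

lemma aestronglyMeasurable_area {f : ℂ → ℂ} (hf : ContinuousOn f (ball 0 1)) :
    AEStronglyMeasurable f area :=
  (hf.aestronglyMeasurable measurableSet_ball).smul_measure _

lemma memLp_area_of_bounded {f : ℂ → ℂ} (hf : ContinuousOn f (ball 0 1)) {C : ℝ}
    (hC : ∀ z ∈ ball (0 : ℂ) 1, ‖f z‖ ≤ C) (q : ℝ≥0∞) : MemLp f q area :=
  MemLp.of_bound (aestronglyMeasurable_area hf) C (ae_area_of_forall_mem hC)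

lemma memLp_area_of_continuousOn_closedBall {f : ℂ → ℂ} (hf : ContinuousOn f (closedBall 0 1))
    (q : ℝ≥0∞) : MemLp f q area := by
  obtain ⟨C, hC⟩ := (isCompact_closedBall (0 : ℂ) 1).exists_bound_of_continuousOn hf
  exact memLp_area_of_bounded (hf.mono ball_subset_closedBall)
    (fun z hz => hC z (ball_subset_closedBall hz)) q

lemma eqOn_ball_of_ae_eq_area {f g : ℂ → ℂ} (h : f =ᵐ[area] g) (hf : ContinuousOn f (ball 0 1))
    (hg : ContinuousOn g (ball 0 1)) : Set.EqOn f g (ball 0 1) :=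
  Measure.eqOn_open_of_ae_eq (ae_area_iff.1 h) isOpen_ball hf hg

/-! ### Pairing with monomials. -/

/-- Integration over the unit disc in polar coordinates. -/
lemma setIntegral_ball_eq_polar {g : ℂ → ℂ} (hg : ContinuousOn g (ball 0 1))
    (hi : IntegrableOn g (ball 0 1)) :
    ∫ z in ball (0 : ℂ) 1, g z =
      ∫ r in Set.Ioo (0 : ℝ) 1, (r : ℂ) * ∫ θ in Set.Ioo (-Real.pi) Real.pi,
        g (circleMap 0 r θ) := by
  have hmap : ∀ p : ℝ × ℝ, Complex.polarCoord.symm p = circleMap 0 p.1 p.2 := fun p => by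
    rw [Complex.polarCoord_symm_apply, circleMap, zero_add, Complex.exp_mul_I]
    simp
  set S : Set (ℝ × ℝ) := Set.Ioo (0 : ℝ) 1 ×ˢ Set.Ioo (-Real.pi) Real.pi with hS
  have hSm : MeasurableSet S := measurableSet_Ioo.prod measurableSet_Ioo
  have hST : polarCoord.target ∩ S = S := by
    refine Set.inter_eq_right.2 ?_
    rw [polarCoord_target]
    exact Set.prod_mono (fun x hx => hx.1) subset_rfl
  have hmem : ∀ p ∈ polarCoord.target, (circleMap 0 p.1 p.2 ∈ ball (0 : ℂ) 1 ↔ p ∈ S) := by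
    intro p hp
    rw [polarCoord_target] at hp
    have h1 : (0 : ℝ) < p.1 := hp.1
    simp only [mem_ball_zero_iff, norm_circleMap_zero, abs_of_pos h1, hS, Set.mem_prod,
      Set.mem_Ioo, h1, true_and]
    exact ⟨fun h => ⟨h, hp.2⟩, fun h => h.1⟩
  have hcm : Continuous fun p : ℝ × ℝ => circleMap 0 p.1 p.2 := by
    simp only [circleMap]; fun_prop
  have hSb : Set.MapsTo (fun p : ℝ × ℝ => circleMap 0 p.1 p.2) S (ball 0 1) := fun p hp =>
    (hmem p (by rw [← hST] at hp; exact hp.1)).2 hp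
  have hcont : ContinuousOn (fun p : ℝ × ℝ => (p.1 : ℂ) * g (circleMap 0 p.1 p.2)) S :=
    (by fun_prop : Continuous fun p : ℝ × ℝ => (p.1 : ℂ)).continuousOn.mul
      (hg.comp hcm.continuousOn hSb)
  -- Fubini needs integrability of the polar integrand; it comes from the change of variables for
  -- `∫⁻` applied to the norm.
  have hint : IntegrableOn (fun p : ℝ × ℝ => (p.1 : ℂ) * g (circleMap 0 p.1 p.2)) S := by
    refine ⟨hcont.aestronglyMeasurable hSm, ?_⟩
    have hfin := hi.hasFiniteIntegral
    rw [hasFiniteIntegral_iff_enorm] at hfin ⊢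
    rw [← lintegral_indicator measurableSet_ball, ← Complex.lintegral_comp_polarCoord_symm] at hfin
    refine lt_of_le_of_lt ?_ hfin
    rw [← hST]
    refine le_trans (le_of_eq ?_) (lintegral_mono_set (Set.inter_subset_left (t := S)))
    refine setLIntegral_congr_fun (polarCoord.open_target.measurableSet.inter hSm) ?_
    intro p hp
    have h1 : (0 : ℝ) < p.1 := by have := hp.2; exact this.1.1
    simp only [hmap]
    rw [Set.indicator_of_mem ((hmem p hp.1).2 hp.2), enorm_mul, smul_eq_mul]
    congr 1
    rw [← ofReal_norm, Complex.norm_real, Real.norm_of_nonneg h1.le]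
  rw [← integral_indicator measurableSet_ball, ← Complex.integral_comp_polarCoord_symm]
  have : ∫ p in polarCoord.target, p.1 • (ball (0 : ℂ) 1).indicator g (Complex.polarCoord.symm p) =
      ∫ p in S, (p.1 : ℂ) * g (circleMap 0 p.1 p.2) := by
    rw [← hST, ← setIntegral_indicator hSm]
    refine setIntegral_congr_fun polarCoord.open_target.measurableSet fun p hp => ?_
    simp only [hmap, Complex.real_smul]
    by_cases h : p ∈ S
    · rw [Set.indicator_of_mem h, Set.indicator_of_mem ((hmem p hp).2 h)]
    · rw [Set.indicator_of_notMem h, Set.indicator_of_notMem (fun h' => h ((hmem p hp).1 h')),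
        mul_zero]
  rw [this, Measure.volume_eq_prod, hS, setIntegral_prod _ hint]
  refine setIntegral_congr_fun measurableSet_Ioo fun r _ => ?_
  exact integral_const_mul (r : ℂ) fun θ => g (circleMap 0 r θ)

/-- On the circle of radius r one has conj ζ = r²/ζ, which turns the pairing into Cauchy's integral
for a Taylor coefficient. -/
lemma integral_circleMap_mul_conj_pow {f : ℂ → ℂ} (hf : DifferentiableOn ℂ f (ball 0 1)) (n : ℕ)
    {r : ℝ} (hr : r ∈ Set.Ioo (0 : ℝ) 1) :
    ∫ θ in Set.Ioo (-Real.pi) Real.pi, f (circleMap 0 r θ) * conj (circleMap 0 r θ ^ n) =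
      2 * Real.pi * r ^ (2 * n) * (iteratedDeriv n f 0 / n.factorial) := by
  have hc : (r : ℂ) ≠ 0 := by exact_mod_cast hr.1.ne'
  have hC := (hf.mono (closedBall_subset_ball hr.2)).circleIntegral_one_div_sub_center_pow_smul
    hr.1 n
  have hper : Function.Periodic
      (fun θ => f (circleMap 0 r θ) * conj (circleMap 0 r θ ^ n)) (2 * Real.pi) := fun θ => by
    simp only [periodic_circleMap 0 r θ]
  have h2 : ∫ θ in Set.Ioo (-Real.pi) Real.pi, f (circleMap 0 r θ) * conj (circleMap 0 r θ ^ n) =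
      ∫ θ in (0 : ℝ)..2 * Real.pi, f (circleMap 0 r θ) * conj (circleMap 0 r θ ^ n) := by
    rw [← integral_Ioc_eq_integral_Ioo, ← intervalIntegral.integral_of_le (by linarith [Real.pi_pos])]
    have := hper.intervalIntegral_add_eq (-Real.pi) 0
    rw [zero_add] at this
    rw [← this]
    congr 1
    ring
  rw [h2]
  have h3 : ∀ θ : ℝ, f (circleMap 0 r θ) * conj (circleMap 0 r θ ^ n) =
      ((r : ℂ) ^ (2 * n) * (I)⁻¹) * (deriv (circleMap 0 r) θ •
        ((1 / (circleMap 0 r θ - 0) ^ (n + 1)) • f (circleMap 0 r θ))) := fun θ => by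
    have hne : circleMap 0 r θ ≠ 0 := by simpa using circleMap_ne_center (c := 0) (θ := θ) hr.1.ne'
    have hcj : conj (circleMap 0 r θ) = (r : ℂ) ^ 2 / circleMap 0 r θ := by
      rw [eq_div_iff hne, mul_comm, Complex.mul_conj, Complex.normSq_eq_norm_sq,
        norm_circleMap_zero, sq_abs]
      push_cast; ring
    rw [deriv_circleMap, map_pow, hcj, smul_eq_mul, smul_eq_mul, sub_zero, pow_mul, div_pow]
    field_simp
    ring
  simp_rw [h3]
  rw [intervalIntegral.integral_const_mul]
  change _ * (∮ z in C(0, r), (1 / (z - 0) ^ (n + 1)) • f z) = _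
  rw [hC, smul_eq_mul]
  field_simp

/-- Pairing an analytic function with a monomial gives a Taylor coefficient. -/
lemma integral_mul_conj_pow {f : ℂ → ℂ} (hf : DifferentiableOn ℂ f (ball 0 1))
    (hi : Integrable f area) (n : ℕ) :
    ∫ z, f z * conj (z ^ n) ∂area = iteratedDeriv n f 0 / n.factorial / (n + 1) := by
  have hcont : ContinuousOn (fun z : ℂ => f z * conj (z ^ n)) (ball 0 1) :=
    hf.continuousOn.mul (by fun_prop)
  have hint : Integrable (fun z : ℂ => f z * conj (z ^ n)) area := by
    refine hi.mono (aestronglyMeasurable_area hcont) (ae_area_of_forall_mem fun z hz => ?_)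
    rw [norm_mul, RCLike.norm_conj, norm_pow]
    exact mul_le_of_le_one_right (norm_nonneg _)
      (pow_le_one₀ (norm_nonneg _) (mem_ball_zero_iff.1 hz).le)
  rw [integral_area, setIntegral_ball_eq_polar hcont (integrable_area_iff.1 hint)]
  rw [setIntegral_congr_fun measurableSet_Ioo (g := fun r : ℝ =>
    (2 * Real.pi * (iteratedDeriv n f 0 / n.factorial)) * ((r ^ (2 * n + 1) : ℝ) : ℂ))
    (fun r hr => by
      simp only [integral_circleMap_mul_conj_pow hf n hr]; push_cast; ring)]
  rw [integral_const_mul, integral_complex_ofReal, ← integral_Ioc_eq_integral_Ioo,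
    ← intervalIntegral.integral_of_le zero_le_one, integral_pow]
  have hpi : (Real.pi : ℂ) ≠ 0 := by exact_mod_cast Real.pi_ne_zero
  have hn : (n : ℂ) + 1 ≠ 0 := by exact_mod_cast n.succ_ne_zero
  have hf0 : (n.factorial : ℂ) ≠ 0 := by exact_mod_cast n.factorial_ne_zero
  push_cast
  have h2 : (2 * (n : ℂ) + 1 + 1) = 2 * (n + 1) := by ring
  rw [h2]
  field_simp
  simp

lemma hasSum_of_eq {f g : ℕ → ℂ} {a b : ℂ} (h : HasSum f a) (hfg : ∀ n, g n = f n) (hab : b = a) :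
    HasSum g b := by
  rwa [funext hfg, hab]

lemma norm_pow_le_one_of_mem_ball {z : ℂ} (hz : z ∈ ball (0 : ℂ) 1) (n : ℕ) : ‖z ^ n‖ ≤ 1 := by
  rw [norm_pow]
  exact pow_le_one₀ (norm_nonneg _) (mem_ball_zero_iff.1 hz).le

/-- Integration term by term against an absolutely convergent series of monomials. -/
lemma hasSum_integral_mul_conj {h f : ℂ → ℂ} {a : ℕ → ℂ} {e : ℕ → ℕ} (hh : Integrable h area)
    (ha : Summable fun n => ‖a n‖)
    (hf : ∀ z ∈ ball (0 : ℂ) 1, HasSum (fun n => a n * z ^ e n) (f z)) :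
    HasSum (fun n => conj (a n) * ∫ z, h z * conj (z ^ e n) ∂area)
      (∫ z, h z * conj (f z) ∂area) := by
  have hle : ∀ n, ∀ z ∈ ball (0 : ℂ) 1, ‖h z * conj (a n * z ^ e n)‖ ≤ ‖a n‖ * ‖h z‖ := by
    intro n z hz
    rw [norm_mul, RCLike.norm_conj, norm_mul, mul_comm]
    exact mul_le_mul_of_nonneg_right
      (mul_le_of_le_one_right (norm_nonneg _) (norm_pow_le_one_of_mem_ball hz _)) (norm_nonneg _)
  have hint : ∀ n, Integrable (fun z => h z * conj (a n * z ^ e n)) area := by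
    intro n
    refine (hh.norm.const_mul ‖a n‖).mono ?_ (ae_area_of_forall_mem fun z hz => ?_)
    · exact hh.aestronglyMeasurable.mul (Continuous.aestronglyMeasurable (by fun_prop))
    · rw [Real.norm_of_nonneg (by positivity)]
      exact hle n z hz
  have hs : Summable fun n => ∫ z, ‖h z * conj (a n * z ^ e n)‖ ∂area := by
    refine Summable.of_nonneg_of_le (fun n => integral_nonneg fun z => norm_nonneg _) (fun n => ?_)
      (ha.mul_right (∫ z, ‖h z‖ ∂area))
    rw [← integral_const_mul]
    exact integral_mono_ae (hint n).norm (hh.norm.const_mul _)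
      (ae_area_of_forall_mem fun z hz => hle n z hz)
  have key := hasSum_integral_of_summable_integral_norm hint hs
  have h1 : ∫ z, ∑' n, h z * conj (a n * z ^ e n) ∂area = ∫ z, h z * conj (f z) ∂area := by
    refine integral_congr_ae (ae_area_of_forall_mem fun z hz => ?_)
    have h2 := ((hf z hz).mapL (conjCLE : ℂ →L[ℝ] ℂ)).mul_left (h z)
    exact h2.tsum_eq
  rw [h1] at key
  refine hasSum_of_eq key (fun n => ?_) rfl
  rw [← integral_const_mul]
  congr 1
  ext z
  rw [map_mul]; ring

/-! ### Kernels reproducing derivatives. -/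

/-- The kernel which represents the `j`-th derivative at `w`, up to a factor `(j + 1)!`. -/
def kernel (w : ℂ) (j : ℕ) (z : ℂ) : ℂ := z ^ j / (1 - conj w * z) ^ (j + 2)

lemma one_sub_conj_mul_ne_zero {w z : ℂ} (h : ‖w‖ * ‖z‖ < 1) : 1 - conj w * z ≠ 0 := by
  intro h0
  have : ‖conj w * z‖ = 1 := by rw [← sub_eq_zero.1 h0, norm_one]
  rw [norm_mul, RCLike.norm_conj] at this
  linarith

lemma hasSum_kernel {w z : ℂ} (hw : ‖w‖ < 1) (hz : z ∈ ball (0 : ℂ) 1) (j : ℕ) :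
    HasSum (fun n => (((n + (j + 1)).choose (j + 1) : ℕ) * conj w ^ n) * z ^ (n + j))
      (kernel w j z) := by
  have h1 : ‖conj w * z‖ < 1 := by
    rw [norm_mul, RCLike.norm_conj]
    exact mul_lt_one_of_nonneg_of_lt_one_left (norm_nonneg _) hw (mem_ball_zero_iff.1 hz).le
  have h2 := (hasSum_choose_mul_geometric_of_norm_lt_one (j + 1) h1).mul_left (z ^ j)
  refine hasSum_of_eq h2 (fun n => ?_) ?_
  · rw [mul_pow, pow_add]; ring
  · rw [kernel]; ring

lemma iteratedDeriv_differentiableOn_ball {f : ℂ → ℂ} {R : ℝ}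
    (hf : DifferentiableOn ℂ f (ball 0 R)) (j : ℕ) :
    DifferentiableOn ℂ (iteratedDeriv j f) (ball 0 R) := by
  induction j with
  | zero => simpa using hf
  | succ j ih => rw [iteratedDeriv_succ]; exact ih.deriv isOpen_ball

/-- The reproducing property of the kernels. -/
lemma integral_mul_conj_kernel {f : ℂ → ℂ} (hf : DifferentiableOn ℂ f (ball 0 1))
    (hi : Integrable f area) {w : ℂ} (hw : ‖w‖ < 1) (j : ℕ) :
    ∫ z, f z * conj (kernel w j z) ∂area = iteratedDeriv j f w / (j + 1).factorial := by
  have hs : Summable fun n => ‖(((n + (j + 1)).choose (j + 1) : ℕ) : ℂ) * conj w ^ n‖ := by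
    have : ‖conj w‖ < 1 := by rwa [RCLike.norm_conj]
    exact (summable_choose_mul_geometric_of_norm_lt_one (j + 1) this).norm
  have h1 := hasSum_integral_mul_conj hi hs (fun z hz => hasSum_kernel hw hz j)
  have h2 := (hasSum_taylorSeries_on_ball (iteratedDeriv_differentiableOn_ball hf j)
    (mem_ball_zero_iff.2 hw)).div_const ((j + 1).factorial : ℂ)
  refine h1.unique (hasSum_of_eq h2 (fun n => ?_) rfl)
  rw [integral_mul_conj_pow hf hi]
  have h3 : iteratedDeriv n (iteratedDeriv j f) 0 = iteratedDeriv (n + j) f 0 := by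
    simp only [iteratedDeriv_eq_iterate, Function.iterate_add_apply]
  -- The binomial coefficient cancels the weight (n + j)!·(n + j + 1) from the monomial pairing,
  -- leaving 1/((j + 1)!·n!), the Taylor weight of the j-th derivative.
  have h4 : (((n + (j + 1)).choose (j + 1) : ℕ) : ℂ) * (j + 1).factorial * n.factorial =
      (n + j).factorial * (((n + j : ℕ) : ℂ) + 1) := by
    have := Nat.add_choose_mul_factorial_mul_factorial n (j + 1)
    have h5 : (n + (j + 1)).factorial = (n + j).factorial * (n + j + 1) := by
      rw [← add_assoc, Nat.factorial_succ, mul_comm]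
    rw [h5] at this
    have h6 := congrArg (Nat.cast (R := ℂ)) this
    push_cast at h6 ⊢
    linear_combination h6
  have e1 : ((n + j).factorial : ℂ) ≠ 0 := by exact_mod_cast (n + j).factorial_ne_zero
  have e2 : ((n + j : ℕ) : ℂ) + 1 ≠ 0 := by exact_mod_cast (n + j).succ_ne_zero
  have e3 : (n.factorial : ℂ) ≠ 0 := by exact_mod_cast n.factorial_ne_zero
  have e4 : ((j + 1).factorial : ℂ) ≠ 0 := by exact_mod_cast (j + 1).factorial_ne_zero
  rw [h3, sub_zero, smul_eq_mul, smul_eq_mul, map_mul, map_pow, conj_conj, map_natCast]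
  field_simp
  linear_combination (w ^ n * iteratedDeriv (n + j) f 0) * h4

/-! ### Parseval's formula and an expansion inequality. -/

lemma integral_pow_mul_conj_pow (k n : ℕ) :
    ∫ z, z ^ k * conj (z ^ n) ∂area = if n = k then ((n : ℂ) + 1)⁻¹ else 0 := by
  rw [integral_mul_conj_pow (f := fun z => z ^ k) (by fun_prop)
    ((memLp_area_of_continuousOn_closedBall (by fun_prop) 1).integrable le_rfl),
    iteratedDeriv_fun_pow_zero]
  split_ifs with h
  · have : (n.factorial : ℂ) ≠ 0 := by exact_mod_cast n.factorial_ne_zero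
    subst h; field_simp
  · simp

/-- Parseval's formula for the area measure. -/
lemma hasSum_integral_norm_sq {f : ℂ → ℂ} {a : ℕ → ℂ} (hfc : MemLp f 2 area)
    (ha : Summable fun n => ‖a n‖)
    (hf : ∀ z ∈ ball (0 : ℂ) 1, HasSum (fun n => a n * z ^ n) (f z)) :
    HasSum (fun n : ℕ => ‖a n‖ ^ 2 / (n + 1)) (∫ z, ‖f z‖ ^ 2 ∂area) := by
  have hfi : Integrable f area := hfc.integrable (by norm_num)
  -- Only the series of f is given, so it is paired termwise with the monomial in the conjugate
  -- slot; orthogonality keeps one term, and conjugating restores the order.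
  have hco : ∀ n : ℕ, ∫ z, f z * conj (z ^ n) ∂area = a n / (n + 1) := by
    intro n
    have h1 := hasSum_integral_mul_conj (h := fun z => z ^ n) (e := fun k => k)
      ((memLp_area_of_continuousOn_closedBall (by fun_prop) 1).integrable le_rfl) ha hf
    simp only [integral_pow_mul_conj_pow] at h1
    have h2 := h1.unique (hasSum_single n fun k hk => by simp [hk])
    have h3 := congrArg conj h2
    rw [← integral_conj] at h3
    simp only [map_mul, conj_conj, if_true, map_inv₀, map_add, map_natCast, map_one] at h3
    rw [div_eq_mul_inv, ← h3]
    congr 1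
    ext z
    rw [map_pow]; ring
  have h1 := hasSum_integral_mul_conj hfi ha hf
  refine Complex.hasSum_ofReal.1 (hasSum_of_eq h1 (fun n => ?_) ?_)
  · rw [hco, ← mul_div_assoc, mul_comm (conj (a n)), mul_conj, normSq_eq_norm_sq]
    push_cast; ring
  · rw [← integral_complex_ofReal]
    congr 1
    ext z
    rw [mul_conj, normSq_eq_norm_sq]

/-- For n > 0 the difference of the two sides is a positive multiple of |n x - (n + 1) c̄ y|². The
left side is an increment of |c|²|A_n|²/n along a sequence with A_n = y, A_{n+1} = x, so sums
telescope. At n = 0 the hypothesis `hy` makes the term with division by zero harmless. -/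
lemma le_norm_sub_sq_of_weights (c : ℂ) (x y : ℂ) (n : ℕ) (hy : n = 0 → y = 0) :
    ‖c‖ ^ 2 * ‖x‖ ^ 2 / (n + 1) - ‖c‖ ^ 2 * ‖y‖ ^ 2 / n ≤
      ‖2 * x - conj c * y‖ ^ 2 / (n + 2) - (2 - ‖c‖ ^ 2) * (‖x‖ ^ 2 / (n + 1)) := by
  rcases Nat.eq_zero_or_pos n with rfl | hn
  · rw [hy rfl]
    simp only [mul_zero, sub_zero, norm_mul, Complex.norm_ofNat, norm_zero]
    apply le_of_eq; push_cast; ring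
  · have hn' : (0 : ℝ) < n := by exact_mod_cast hn
    have key : (‖2 * x - conj c * y‖ ^ 2 / (n + 2) - (2 - ‖c‖ ^ 2) * (‖x‖ ^ 2 / (n + 1))) -
        (‖c‖ ^ 2 * ‖x‖ ^ 2 / (n + 1) - ‖c‖ ^ 2 * ‖y‖ ^ 2 / n) =
        2 / ((n + 2) * (n + 1) * n) * ‖n * x - (n + 1) * (conj c * y)‖ ^ 2 := by
      simp only [← normSq_eq_norm_sq, normSq_apply, sub_re, sub_im, mul_re, mul_im, conj_re, conj_im,
        natCast_re, natCast_im, add_re, add_im, one_re, one_im, re_ofNat, im_ofNat]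
      field_simp
      ring
    have : 0 ≤ 2 / (((n : ℝ) + 2) * (n + 1) * n) * ‖n * x - (n + 1) * (conj c * y)‖ ^ 2 := by
      positivity
    linarith

/-- Multiplication by `z * (2 - conj c * z)` expands the norm by a factor of at least
`√(2 - ‖c‖ ^ 2)`. -/
lemma integral_norm_sq_le_of_hasSum {q : ℂ → ℂ} {a : ℕ → ℂ} (c : ℂ) (hq : MemLp q 2 area)
    (hq' : MemLp (fun z => z * (2 - conj c * z) * q z) 2 area)
    (ha : Summable fun n => ‖a n‖)
    (hs : ∀ z ∈ ball (0 : ℂ) 1, HasSum (fun n => a n * z ^ n) (q z)) :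
    (2 - ‖c‖ ^ 2) * ∫ z, ‖q z‖ ^ 2 ∂area ≤ ∫ z, ‖z * (2 - conj c * z) * q z‖ ^ 2 ∂area := by
  -- `A` shifts the coefficients by one, so that the recurrence `hb1` for the product series also
  -- covers n = 0.
  set A : ℕ → ℂ := fun n => if n = 0 then 0 else a (n - 1) with hA
  have hA0 : A 0 = 0 := rfl
  have hA1 : ∀ n, A (n + 1) = a n := fun n => rfl
  set b : ℕ → ℂ := fun n => if n = 0 then 0 else 2 * A n - conj c * A (n - 1) with hb
  have hb1 : ∀ n, b (n + 1) = 2 * A (n + 1) - conj c * A n := fun n => rfl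
  have hAn : Summable fun n => ‖A n‖ := (summable_nat_add_iff 1).1 (by simpa only [hA1] using ha)
  have hbn : Summable fun n => ‖b n‖ := by
    refine (summable_nat_add_iff 1).1 ?_
    simp only [hb1]
    refine Summable.of_nonneg_of_le (fun n => norm_nonneg _) (fun n => norm_sub_le _ _) ?_
    simp only [norm_mul, hA1]
    exact (ha.mul_left _).add (hAn.mul_left _)
  have hbs : ∀ z ∈ ball (0 : ℂ) 1, HasSum (fun n => b n * z ^ n) (z * (2 - conj c * z) * q z) := by
    intro z hz
    have h1 : HasSum (fun n => A n * z ^ n) (z * q z) := by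
      rw [← hasSum_nat_add_iff' 1]
      simp only [hA1, Finset.range_one, Finset.sum_singleton, hA0, zero_mul, sub_zero]
      refine hasSum_of_eq ((hs z hz).mul_left z) (fun n => ?_) rfl
      rw [pow_succ]; ring
    rw [← hasSum_nat_add_iff' 1]
    simp only [hb1, Finset.range_one, Finset.sum_singleton]
    refine hasSum_of_eq (((hs z hz).mul_left (2 * z)).sub (h1.mul_left (conj c * z)))
      (fun n => ?_) ?_
    · rw [hA1, pow_succ]; ring
    · rw [show b 0 = 0 from rfl]; ring
  have e1 := (hasSum_integral_norm_sq hq ha hs).mul_left (2 - ‖c‖ ^ 2)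
  have e2 := hasSum_integral_norm_sq hq' hbn hbs
  rw [← hasSum_nat_add_iff' 1] at e2
  simp only [Finset.range_one, Finset.sum_singleton, show b 0 = 0 from rfl, norm_zero, hb1] at e2
  have e3 := (e2.sub e1).tendsto_sum_nat
  -- The telescoped boundary term is nonnegative, so the limit of the partial sums is too.
  have e4 : ∀ N : ℕ, ‖c‖ ^ 2 * ‖A N‖ ^ 2 / N ≤ ∑ n ∈ Finset.range N,
      (‖2 * A (n + 1) - conj c * A n‖ ^ 2 / (((n + 1 : ℕ) : ℝ) + 1) -
        (2 - ‖c‖ ^ 2) * (‖a n‖ ^ 2 / (n + 1))) := by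
    intro N
    induction N with
    | zero => simp
    | succ N ih =>
      rw [Finset.sum_range_succ]
      have := le_norm_sub_sq_of_weights c (A (N + 1)) (A N) N (by rintro rfl; rfl)
      rw [hA1] at this ⊢
      have h2 : ((N + 1 : ℕ) : ℝ) = N + 1 := by push_cast; ring
      have h3 : (N : ℝ) + 1 + 1 = N + 2 := by ring
      rw [h2, h3]
      linarith
  have e5 := ge_of_tendsto' e3 fun N => (by positivity :
    (0 : ℝ) ≤ ‖c‖ ^ 2 * ‖A N‖ ^ 2 / N).trans (e4 N)
  simp only [ne_eq, OfNat.ofNat_ne_zero, not_false_eq_true, zero_pow, zero_div, sub_zero] at e5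
  linarith

/-! ### Factoring out zeros and taking roots. -/

lemma analyticAt_of_mem_ball {f : ℂ → ℂ} (hf : DifferentiableOn ℂ f (ball 0 1)) {w : ℂ}
    (hw : w ∈ ball (0 : ℂ) 1) : AnalyticAt ℂ f w :=
  hf.analyticAt (isOpen_ball.mem_nhds hw)

lemma eventuallyEq_of_eqOn_ball {f g : ℂ → ℂ} (h : Set.EqOn f g (ball 0 1)) {w : ℂ}
    (hw : w ∈ ball (0 : ℂ) 1) : f =ᶠ[𝓝 w] g :=
  h.eventuallyEq_of_mem (isOpen_ball.mem_nhds hw)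

/-- The quotient is `dslope f w`, so the factorization holds at every ζ, although g is holomorphic
only on `S`. -/
lemma exists_eqOn_sub_mul {f : ℂ → ℂ} {S : Set ℂ} (hS : IsOpen S) (hf : DifferentiableOn ℂ f S)
    {w : ℂ} (hw : w ∈ S) (h0 : f w = 0) :
    ∃ g : ℂ → ℂ, DifferentiableOn ℂ g S ∧ ∀ ζ, f ζ = (ζ - w) * g ζ := by
  refine ⟨dslope f w, (differentiableOn_dslope (hS.mem_nhds hw)).2 hf, fun ζ => ?_⟩
  have := sub_smul_dslope f w ζ
  rw [h0, sub_zero, smul_eq_mul] at this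
  exact this.symm

lemma exists_eqOn_sub_pow_mul {f : ℂ → ℂ} (hf : DifferentiableOn ℂ f (ball 0 1)) {w : ℂ}
    (hw : w ∈ ball (0 : ℂ) 1) (k : ℕ) (hk : (k : ℕ∞) ≤ analyticOrderAt f w) :
    ∃ g : ℂ → ℂ, DifferentiableOn ℂ g (ball 0 1) ∧
      Set.EqOn f (fun ζ => (ζ - w) ^ k * g ζ) (ball 0 1) := by
  induction k with
  | zero => exact ⟨f, hf, fun ζ _ => by simp⟩
  | succ k ih =>
    obtain ⟨g, hg, hfg⟩ := ih (le_trans (by exact_mod_cast k.le_succ) hk)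
    have h1 : analyticOrderAt f w = k + analyticOrderAt g w := by
      rw [analyticOrderAt_congr (eventuallyEq_of_eqOn_ball hfg hw)]
      change analyticOrderAt ((fun ζ => (ζ - w) ^ k) * g) w = _
      rw [analyticOrderAt_mul (by fun_prop) (analyticAt_of_mem_ball hg hw)]
      congr 1
      exact analyticOrderAt_centeredMonomial
    have h2 : analyticOrderAt g w ≠ 0 := by
      intro h
      rw [h1, h, add_zero] at hk
      exact absurd hk (not_le.2 (by exact_mod_cast k.lt_succ_self))
    obtain ⟨g', hg', hgg'⟩ := exists_eqOn_sub_mul isOpen_ball hg hw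
      (apply_eq_zero_of_analyticOrderAt_ne_zero h2)
    refine ⟨g', hg', fun ζ hζ => ?_⟩
    rw [hfg hζ]
    simp only [hgg' ζ, pow_succ]
    ring

variable {N : ℕ} {z : Fin N → ℂ}

/-- The monic polynomial with zeros `z n` of multiplicities `d n`. -/
def zeroProd (z : Fin N → ℂ) (d : Fin N → ℕ) (ζ : ℂ) : ℂ := ∏ n, (ζ - z n) ^ d n

lemma differentiable_zeroProd (z : Fin N → ℂ) (d : Fin N → ℕ) :
    Differentiable ℂ (zeroProd z d) := by
  unfold zeroProd; fun_prop

/-- An analytic function with the prescribed zeros is a multiple of the polynomial with these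
zeros. -/
lemma exists_eqOn_zeroProd_mul (hz : ∀ n, ‖z n‖ < 1) (hinj : Function.Injective z)
    {d : Fin N → ℕ} {f : ℂ → ℂ} (hf : DifferentiableOn ℂ f (ball 0 1))
    (hd : ∀ n, (d n : ℕ∞) ≤ analyticOrderAt f (z n)) :
    ∃ g : ℂ → ℂ, DifferentiableOn ℂ g (ball 0 1) ∧
      Set.EqOn f (fun ζ => zeroProd z d ζ * g ζ) (ball 0 1) := by
  suffices H : ∀ s : Finset (Fin N), ∃ g : ℂ → ℂ, DifferentiableOn ℂ g (ball 0 1) ∧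
      Set.EqOn f (fun ζ => (∏ n ∈ s, (ζ - z n) ^ d n) * g ζ) (ball 0 1) from H Finset.univ
  intro s
  induction s using Finset.induction_on with
  | empty => exact ⟨f, hf, fun ζ _ => by simp⟩
  | insert a s ha ih =>
    obtain ⟨g, hg, hfg⟩ := ih
    have hza : z a ∈ ball (0 : ℂ) 1 := mem_ball_zero_iff.2 (hz a)
    have han : AnalyticAt ℂ (fun ζ => ∏ n ∈ s, (ζ - z n) ^ d n) (z a) := by fun_prop
    have hne : (∏ n ∈ s, (z a - z n) ^ d n) ≠ 0 := Finset.prod_ne_zero_iff.2 fun n hn =>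
      pow_ne_zero _ (sub_ne_zero.2 (hinj.ne (by rintro rfl; exact ha hn)))
    have h1 : analyticOrderAt f (z a) = analyticOrderAt g (z a) := by
      rw [analyticOrderAt_congr (eventuallyEq_of_eqOn_ball hfg hza)]
      change analyticOrderAt ((fun ζ => ∏ n ∈ s, (ζ - z n) ^ d n) * g) (z a) = _
      rw [analyticOrderAt_mul han (analyticAt_of_mem_ball hg hza),
        han.analyticOrderAt_eq_zero.2 hne, zero_add]
    obtain ⟨g', hg', hgg'⟩ := exists_eqOn_sub_pow_mul hg hza (d a) (h1 ▸ hd a)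
    refine ⟨g', hg', fun ζ hζ => ?_⟩
    rw [hfg hζ]
    simp only [hgg' hζ, Finset.prod_insert ha]
    ring

lemma le_analyticOrderAt_zeroProd_mul (hz : ∀ n, ‖z n‖ < 1) {d : Fin N → ℕ} {g : ℂ → ℂ}
    (hg : DifferentiableOn ℂ g (ball 0 1)) {f : ℂ → ℂ}
    (hfg : Set.EqOn f (fun ζ => zeroProd z d ζ * g ζ) (ball 0 1)) (n : Fin N) :
    (d n : ℕ∞) ≤ analyticOrderAt f (z n) := by
  have hzn : z n ∈ ball (0 : ℂ) 1 := mem_ball_zero_iff.2 (hz n)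
  have hgn := analyticAt_of_mem_ball hg hzn
  have hP : AnalyticAt ℂ (zeroProd z d) (z n) :=
    (differentiable_zeroProd z d).analyticAt _
  rw [analyticOrderAt_congr (eventuallyEq_of_eqOn_ball hfg hzn),
    natCast_le_analyticOrderAt (hP.fun_mul hgn)]
  refine ⟨fun ζ => (∏ k ∈ Finset.univ.erase n, (ζ - z k) ^ d k) * g ζ, by fun_prop, ?_⟩
  refine Eventually.of_forall fun ζ => ?_
  rw [zeroProd, ← Finset.mul_prod_erase _ _ (Finset.mem_univ n), smul_eq_mul, mul_assoc]

lemma iteratedDeriv_pow_mul_zero {g f : ℂ → ℂ} {m : ℕ} (hg : AnalyticAt ℂ g 0)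
    (hf : f =ᶠ[𝓝 0] fun ζ => ζ ^ m * g ζ) : iteratedDeriv m f 0 = m.factorial * g 0 := by
  rw [hf.iteratedDeriv_eq]
  change iteratedDeriv m ((fun ζ : ℂ => ζ ^ m) * g) 0 = _
  rw [iteratedDeriv_mul (by fun_prop) hg.contDiffAt, Finset.sum_eq_single m]
  · rw [iteratedDeriv_fun_pow_zero]; simp
  · intro i _ hi
    rw [iteratedDeriv_fun_pow_zero, if_neg hi]; simp
  · simp

/-- The leading coefficient at the origin of `zeroProd z d`. -/
def leadCoeff (z : Fin N → ℂ) (d : Fin N → ℕ) : ℂ := ∏ n, if z n = 0 then 1 else (-z n) ^ d n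

lemma leadCoeff_ne_zero (z : Fin N → ℂ) (d : Fin N → ℕ) : leadCoeff z d ≠ 0 := by
  refine Finset.prod_ne_zero_iff.2 fun n _ => ?_
  split_ifs with h
  · exact one_ne_zero
  · exact pow_ne_zero _ (neg_ne_zero.2 h)

/-- The extremal functional becomes `leadCoeff z d * g 0` up to a factorial. With `leadCoeff_mul`,
this quantity is raised to the power s when f is, which links the A^{2s} problem to the A² one. -/
lemma iteratedDeriv_zeroProd_mul (z : Fin N → ℂ) (d : Fin N → ℕ) {f g : ℂ → ℂ}
    (hg : DifferentiableOn ℂ g (ball 0 1))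
    (hfg : Set.EqOn f (fun ζ => zeroProd z d ζ * g ζ) (ball 0 1)) :
    iteratedDeriv (multAtZero z d) f 0 =
      (multAtZero z d).factorial * (leadCoeff z d * g 0) := by
  have h0 : (0 : ℂ) ∈ ball (0 : ℂ) 1 := mem_ball_self one_pos
  have hga := analyticAt_of_mem_ball hg h0
  have han : AnalyticAt ℂ (fun ζ => ∏ n, if z n = 0 then 1 else (ζ - z n) ^ d n) 0 := by
    refine Finset.analyticAt_fun_prod _ fun n _ => ?_
    split_ifs <;> fun_prop
  rw [iteratedDeriv_pow_mul_zero
    (g := fun ζ => (∏ n, if z n = 0 then 1 else (ζ - z n) ^ d n) * g ζ) (han.mul hga)]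
  · simp only [zero_sub, leadCoeff]
  · refine (eventuallyEq_of_eqOn_ball hfg h0).trans (Eventually.of_forall fun ζ => ?_)
    simp only
    rw [← mul_assoc, multAtZero, ← Finset.prod_pow_eq_pow_sum, ← Finset.prod_mul_distrib, zeroProd]
    congr 1
    refine Finset.prod_congr rfl fun n _ => ?_
    split_ifs with h
    · rw [h, sub_zero, mul_one]
    · rw [pow_zero, one_mul]

lemma zeroProd_mul (z : Fin N → ℂ) (d : Fin N → ℕ) (s : ℕ) (ζ : ℂ) :
    zeroProd z (fun n => s * d n) ζ = zeroProd z d ζ ^ s := by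
  simp only [zeroProd, ← Finset.prod_pow, ← pow_mul, mul_comm s]

lemma leadCoeff_mul (z : Fin N → ℂ) (d : Fin N → ℕ) (s : ℕ) :
    leadCoeff z (fun n => s * d n) = leadCoeff z d ^ s := by
  simp only [leadCoeff, ← Finset.prod_pow, ite_pow, one_pow, ← pow_mul, mul_comm s]

/-- A zero-free analytic function in the disc has an analytic `s`-th root. -/
lemma exists_pow_eq_of_ne_zero {f : ℂ → ℂ} (hf : DifferentiableOn ℂ f (ball 0 1))
    (h0 : ∀ ζ ∈ ball (0 : ℂ) 1, f ζ ≠ 0) {s : ℕ} (hs : s ≠ 0) :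
    ∃ g : ℂ → ℂ, DifferentiableOn ℂ g (ball 0 1) ∧ ∀ ζ ∈ ball (0 : ℂ) 1, g ζ ^ s = f ζ := by
  have hmem : (0 : ℂ) ∈ ball (0 : ℂ) 1 := mem_ball_self one_pos
  obtain ⟨L, hL0, hL⟩ := ((hf.deriv isOpen_ball).div hf h0).isExactOn_ball.with_val_at 0
    (Complex.log (f 0))
  have hLd : DifferentiableOn ℂ L (ball 0 1) := fun ζ hζ =>
    (hL ζ hζ).differentiableAt.differentiableWithinAt
  have hs' : (s : ℂ) ≠ 0 := by exact_mod_cast hs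
  refine ⟨fun ζ => Complex.exp (L ζ / s), by fun_prop, fun ζ hζ => ?_⟩
  rw [← Complex.exp_nat_mul, mul_div_cancel₀ _ hs']
  -- `L` is a primitive of f'/f, so f·exp(-L) is constant; its value at 0 is 1 by the choice of `L
  -- 0`.
  have hd : ∀ x ∈ ball (0 : ℂ) 1,
      HasDerivAt (fun ζ => f ζ * Complex.exp (-L ζ)) 0 x := by
    intro x hx
    have h1 := (hf.differentiableAt (isOpen_ball.mem_nhds hx)).hasDerivAt
    refine (h1.fun_mul (hL x hx).fun_neg.cexp).congr_deriv ?_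
    have := h0 x hx
    rw [Pi.div_apply]
    field_simp
    ring
  have hconst := isOpen_ball.is_const_of_deriv_eq_zero (convex_ball (0 : ℂ) 1).isPreconnected
    (fun x hx => (hd x hx).differentiableAt.differentiableWithinAt)
    (fun x hx => (hd x hx).deriv) hζ hmem
  simp only [hL0] at hconst
  rw [Complex.exp_neg, Complex.exp_neg, Complex.exp_log (h0 0 hmem), mul_inv_cancel₀ (h0 0 hmem),
    ← div_eq_mul_inv, div_eq_one_iff_eq (Complex.exp_ne_zero _)] at hconst
  exact hconst.symm

/-! ### Inner products and Cauchy–Schwarz in L². -/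

lemma inner_toLp {f g : ℂ → ℂ} (hf : MemLp f 2 area) (hg : MemLp g 2 area) :
    inner ℂ (hf.toLp f) (hg.toLp g) = ∫ ζ, g ζ * conj (f ζ) ∂area := by
  rw [L2.inner_def]
  refine integral_congr_ae ?_
  filter_upwards [hf.coeFn_toLp, hg.coeFn_toLp] with ζ h1 h2
  rw [h1, h2, RCLike.inner_apply]

lemma integral_mul_conj_self (f : ℂ → ℂ) :
    ∫ ζ, f ζ * conj (f ζ) ∂area = ((∫ ζ, ‖f ζ‖ ^ 2 ∂area : ℝ) : ℂ) := by
  rw [← integral_complex_ofReal]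
  congr 1
  ext ζ
  rw [mul_conj, normSq_eq_norm_sq]

lemma norm_toLp_sq {f : ℂ → ℂ} (hf : MemLp f 2 area) :
    ‖hf.toLp f‖ ^ 2 = ∫ ζ, ‖f ζ‖ ^ 2 ∂area := by
  have h := inner_self_eq_norm_sq_to_K (𝕜 := ℂ) (hf.toLp f)
  rw [inner_toLp hf hf, integral_mul_conj_self] at h
  exact Complex.ofReal_injective (by rw [h]; push_cast; rfl)

lemma norm_integral_mul_conj_sq_le {f g : ℂ → ℂ} (hf : MemLp f 2 area) (hg : MemLp g 2 area) :
    ‖∫ ζ, f ζ * conj (g ζ) ∂area‖ ^ 2 ≤ (∫ ζ, ‖f ζ‖ ^ 2 ∂area) * ∫ ζ, ‖g ζ‖ ^ 2 ∂area := by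
  rw [← inner_toLp hg hf, ← norm_toLp_sq hf, ← norm_toLp_sq hg, ← mul_pow, mul_comm ‖hf.toLp f‖]
  exact pow_le_pow_left₀ (norm_nonneg _) (norm_inner_le_norm _ _) 2

lemma ae_eq_of_integral_mul_conj_eq_one {f g : ℂ → ℂ} (hf : MemLp f 2 area) (hg : MemLp g 2 area)
    (hf1 : ∫ ζ, ‖f ζ‖ ^ 2 ∂area = 1) (hg1 : ∫ ζ, ‖g ζ‖ ^ 2 ∂area = 1)
    (hfg : ∫ ζ, f ζ * conj (g ζ) ∂area = 1) : f =ᵐ[area] g := by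
  rw [← norm_toLp_sq hf, pow_eq_one_iff_of_nonneg (norm_nonneg _) two_ne_zero] at hf1
  rw [← norm_toLp_sq hg, pow_eq_one_iff_of_nonneg (norm_nonneg _) two_ne_zero] at hg1
  rw [← inner_toLp hg hf, inner_eq_one_iff_of_norm_eq_one hg1 hf1, MemLp.toLp_eq_toLp_iff] at hfg
  exact hfg.symm

/-! ### The linear extremal problem. -/

lemma differentiableOn_kernel (w : ℂ) (j : ℕ) :
    DifferentiableOn ℂ (kernel w j) {ζ | 1 - conj w * ζ ≠ 0} := by
  unfold kernel
  exact fun _ hζ => DifferentiableAt.differentiableWithinAt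
    (by have := pow_ne_zero (j + 2) hζ; fun_prop (disch := exact this))

lemma continuousOn_kernel {w : ℂ} (hw : ‖w‖ < 1) (j : ℕ) :
    ContinuousOn (kernel w j) (closedBall 0 1) :=
  (differentiableOn_kernel w j).continuousOn.mono fun _ hζ =>
    one_sub_conj_mul_ne_zero (mul_lt_one_of_nonneg_of_lt_one_left (norm_nonneg _) hw
      (mem_closedBall_zero_iff.1 hζ))

/-- The coefficients are those of the orthogonal projection of v onto the finite-dimensional span of
the K i. -/
lemma exists_extremal_aux {ι : Type*} (t : Finset ι) {v : ℂ → ℂ} {K : ι → ℂ → ℂ}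
    (hv : MemLp v 2 area) (hK : ∀ i, MemLp (K i) 2 area) :
    ∃ c : ι → ℂ, ∀ i ∈ t, ∫ ζ, (v ζ - ∑ i ∈ t, c i * K i ζ) * conj (K i ζ) ∂area = 0 := by
  classical
  let k : ι → Lp ℂ 2 area := fun i => (hK i).toLp (K i)
  let S : Submodule ℂ (Lp ℂ 2 area) := Submodule.span ℂ (k '' t)
  have : FiniteDimensional ℂ S := FiniteDimensional.span_of_finite ℂ (t.finite_toSet.image k)
  obtain ⟨c, hc⟩ := Submodule.mem_span_image_finset_iff_exists_fun' ℂ |>.1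
    (S.starProjection_apply_mem (hv.toLp v))
  refine ⟨c, fun i hi => ?_⟩
  have hΦ : MemLp (fun ζ => v ζ - ∑ i ∈ t, c i * K i ζ) 2 area :=
    hv.sub (memLp_finsetSum t fun i _ => (hK i).const_mul (c i))
  have hu : hΦ.toLp _ = hv.toLp v - S.starProjection (hv.toLp v) := by
    rw [← hc]
    apply Lp.ext
    have h1 : ∀ᵐ ζ ∂area, ∀ i ∈ t, (k i : ℂ → ℂ) ζ = K i ζ :=
      (ae_ball_iff t.countable_toSet).2 fun i _ => (hK i).coeFn_toLp
    have h2 : ∀ᵐ ζ ∂area, ∀ i ∈ t, ((c i • k i : Lp ℂ 2 area) : ℂ → ℂ) ζ = c i * k i ζ :=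
      (ae_ball_iff t.countable_toSet).2 fun i _ => Lp.coeFn_smul (c i) (k i)
    filter_upwards [hΦ.coeFn_toLp, hv.coeFn_toLp, Lp.coeFn_sub (hv.toLp v) (∑ i ∈ t, c i • k i),
      Lp.coeFn_finsetSum t fun i => c i • k i, h1, h2] with ζ e1 e2 e3 e4 e5 e6
    rw [e1, e3, Pi.sub_apply, e2, e4, Finset.sum_apply]
    congr 1
    exact Finset.sum_congr rfl fun i hi => by rw [e6 i hi, e5 i hi]
  have h3 := S.starProjection_inner_eq_zero (hv.toLp v) (k i)
    (Submodule.subset_span (Set.mem_image_of_mem k hi))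
  rw [← hu, ← inner_conj_symm, inner_toLp (hK i) hΦ, map_eq_zero] at h3
  exact h3

/-- The solution of the linear extremal problem in `A²`, as a combination of kernels. -/
lemma exists_extremal (hz : ∀ n, ‖z n‖ < 1) (e : Fin N → ℕ) :
    ∃ c : Fin N → ℕ → ℂ, ∀ Φ : ℂ → ℂ,
      (Φ = fun ζ => ζ ^ multAtZero z e - ∑ n, ∑ j ∈ Finset.range (e n), c n j * kernel (z n) j ζ) →
      (∀ n, (e n : ℕ∞) ≤ analyticOrderAt Φ (z n)) ∧
      ∀ f : ℂ → ℂ, DifferentiableOn ℂ f (ball 0 1) → MemLp f 2 area →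
        (∀ n, (e n : ℕ∞) ≤ analyticOrderAt f (z n)) →
        ∫ ζ, f ζ * conj (Φ ζ) ∂area =
          iteratedDeriv (multAtZero z e) f 0 / (multAtZero z e).factorial / (multAtZero z e + 1) := by
  have hKc : ∀ i : (_ : Fin N) × ℕ, ContinuousOn (kernel (z i.1) i.2) (closedBall 0 1) :=
    fun i => continuousOn_kernel (hz i.1) i.2
  have hK : ∀ i : (_ : Fin N) × ℕ, MemLp (kernel (z i.1) i.2) 2 area := fun i =>
    memLp_area_of_continuousOn_closedBall (hKc i) 2
  have hv : MemLp (fun ζ : ℂ => ζ ^ multAtZero z e) 2 area :=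
    memLp_area_of_continuousOn_closedBall (by fun_prop) 2
  obtain ⟨c, hc⟩ := exists_extremal_aux (Finset.univ.sigma fun n => Finset.range (e n)) hv hK
  refine ⟨fun n j => c ⟨n, j⟩, fun Φ hΦ => ?_⟩
  have hΦ' : ∀ ζ, Φ ζ = ζ ^ multAtZero z e -
      ∑ i ∈ Finset.univ.sigma fun n => Finset.range (e n), c i * kernel (z i.1) i.2 ζ := fun ζ => by
    rw [hΦ, Finset.sum_sigma]
  simp only [← hΦ'] at hc
  have hΦd : DifferentiableOn ℂ Φ (ball 0 1) := by
    rw [hΦ]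
    refine DifferentiableOn.sub (by fun_prop) (DifferentiableOn.fun_sum fun n _ =>
      DifferentiableOn.fun_sum fun j _ => ((differentiableOn_kernel (z n) j).mono
        fun ζ hζ => ?_).const_mul _)
    exact one_sub_conj_mul_ne_zero (mul_lt_one_of_nonneg_of_lt_one_left (norm_nonneg _) (hz n)
      (mem_ball_zero_iff.1 hζ).le)
  have hΦm : MemLp Φ 2 area := by
    rw [funext hΦ']
    exact hv.sub (memLp_finsetSum _ fun i _ => (hK i).const_mul (c i))
  have hΦi : Integrable Φ area := hΦm.integrable (by norm_num)
  constructor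
  -- Orthogonality of Φ to the kernel indexed by (n, j) is the vanishing of its j-th derivative at z
  -- n.
  · intro n
    have hzn : z n ∈ ball (0 : ℂ) 1 := mem_ball_zero_iff.2 (hz n)
    rw [natCast_le_analyticOrderAt_iff_iteratedDeriv_eq_zero (analyticAt_of_mem_ball hΦd hzn)]
    intro j hj
    have h1 := hc ⟨n, j⟩ (by simpa using hj)
    rw [integral_mul_conj_kernel hΦd hΦi (hz n)] at h1
    exact (div_eq_zero_iff.1 h1).resolve_right (by exact_mod_cast (j + 1).factorial_ne_zero)
  · intro f hf hfm hford
    have hfi : Integrable f area := hfm.integrable (by norm_num)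
    have hint : ∀ {g : ℂ → ℂ}, MemLp g 2 area → Integrable (fun ζ => f ζ * conj (g ζ)) area :=
      fun {g} hg => hfm.integrable_mul hg.star
    -- The kernels annihilate every f with the prescribed zeros, so only the monomial in Φ
    -- contributes.
    have hzero : ∀ i ∈ Finset.univ.sigma fun n => Finset.range (e n),
        ∫ ζ, f ζ * conj (c i * kernel (z i.1) i.2 ζ) ∂area = 0 := by
      intro i hi
      have hzn : z i.1 ∈ ball (0 : ℂ) 1 := mem_ball_zero_iff.2 (hz i.1)
      have h2 := (natCast_le_analyticOrderAt_iff_iteratedDeriv_eq_zero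
        (analyticAt_of_mem_ball hf hzn)).1 (hford i.1) i.2 (by simpa using hi)
      have h3 : ∀ ζ, f ζ * conj (c i * kernel (z i.1) i.2 ζ) =
          conj (c i) * (f ζ * conj (kernel (z i.1) i.2 ζ)) := fun ζ => by rw [map_mul]; ring
      simp only [h3]
      rw [integral_const_mul, integral_mul_conj_kernel hf hfi (hz i.1), h2, zero_div, mul_zero]
    rw [← integral_mul_conj_pow hf hfi]
    have h4 : ∀ ζ, f ζ * conj (Φ ζ) = f ζ * conj (ζ ^ multAtZero z e) -
        ∑ i ∈ Finset.univ.sigma fun n => Finset.range (e n),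
          f ζ * conj (c i * kernel (z i.1) i.2 ζ) := fun ζ => by
      rw [hΦ', map_sub, map_sum, mul_sub, Finset.mul_sum]
    simp only [h4]
    rw [integral_sub (hint hv) (integrable_finsetSum _ fun i _ => hint ((hK i).const_mul (c i))),
      integral_finsetSum _ fun i _ => hint ((hK i).const_mul (c i)), Finset.sum_eq_zero hzero,
      sub_zero]

/-! ### Absence of additional zeros. -/

lemma exists_ball_subset_of_closedBall_subset {U : Set ℂ} (hU : IsOpen U)
    (h : closedBall (0 : ℂ) 1 ⊆ U) : ∃ R : ℝ, 1 < R ∧ ball (0 : ℂ) R ⊆ U := by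
  obtain ⟨δ, hδ, hδU⟩ := (isCompact_closedBall (0 : ℂ) 1).exists_thickening_subset_open hU h
  rw [thickening_closedBall hδ zero_le_one] at hδU
  exact ⟨δ + 1, by linarith, hδU⟩

lemma exists_summable_hasSum {q : ℂ → ℂ} {U : Set ℂ} (hU : IsOpen U)
    (h : closedBall (0 : ℂ) 1 ⊆ U) (hq : DifferentiableOn ℂ q U) :
    ∃ a : ℕ → ℂ, (Summable fun n => ‖a n‖) ∧
      ∀ ζ ∈ ball (0 : ℂ) 1, HasSum (fun n => a n * ζ ^ n) (q ζ) := by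
  obtain ⟨R, hR, hRU⟩ := exists_ball_subset_of_closedBall_subset hU h
  have hs : ∀ ζ ∈ ball (0 : ℂ) R,
      HasSum (fun n : ℕ => (iteratedDeriv n q 0 / n.factorial) * ζ ^ n) (q ζ) := by
    intro ζ hζ
    refine hasSum_of_eq (hasSum_taylorSeries_on_ball (hq.mono hRU) hζ) (fun n => ?_) rfl
    rw [sub_zero, smul_eq_mul, smul_eq_mul]
    ring
  refine ⟨_, ?_, fun ζ hζ => hs ζ (ball_subset_ball hR.le hζ)⟩
  -- Since R > 1 the Taylor series converges at 1, and convergence there gives summable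
  -- coefficients.
  simpa using (hs 1 (by simpa using hR)).summable.norm

/-- Up to a constant, (ζ - w)(2 - |w|² - w̄ζ)/(1 - w̄ζ)² is the A² divisor of the single point w ≠
0. The lemma says that multiplying by it expands norms; q clears the denominator. -/
lemma integral_norm_sq_le_of_mul {q : ℂ → ℂ} {U : Set ℂ} (hU : IsOpen U)
    (h : closedBall (0 : ℂ) 1 ⊆ U) (hq : DifferentiableOn ℂ q U) (w : ℂ) :
    (2 - ‖w‖ ^ 2) * ∫ ζ, ‖(1 - conj w * ζ) ^ 2 * q ζ‖ ^ 2 ∂area ≤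
      ∫ ζ, ‖(ζ - w) * ((2 - ‖w‖ ^ 2 - conj w * ζ) * q ζ)‖ ^ 2 ∂area := by
  obtain ⟨a, ha, has⟩ := exists_summable_hasSum hU h hq
  have hqc : ContinuousOn q (closedBall 0 1) := hq.continuousOn.mono h
  have hmem : ∀ {p : ℂ → ℂ}, Continuous p → MemLp (fun ζ => p ζ * q ζ) 2 area := fun {p} hp =>
    memLp_area_of_continuousOn_closedBall (hp.continuousOn.mul hqc) 2
  have m0 : MemLp q 2 area := memLp_area_of_continuousOn_closedBall hqc 2
  have m1 := hmem (p := fun ζ => ζ * (2 - conj w * ζ)) (by fun_prop)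
  have m2 := hmem (p := fun ζ => (1 - conj w * ζ) ^ 2) (by fun_prop)
  have key := integral_norm_sq_le_of_hasSum w m0 m1 ha has
  have hint : ∀ {p : ℂ → ℂ}, MemLp p 2 area → Integrable (fun ζ => ‖p ζ‖ ^ 2) area := fun {p} hp =>
    (memLp_two_iff_integrable_sq_norm hp.aestronglyMeasurable).1 hp
  -- This pointwise identity reduces the claim to the inequality `key`, whose defect enters with the
  -- nonnegative weight (1 - |w|²)².
  have hid : ∀ ζ, ‖(ζ - w) * (2 - ‖w‖ ^ 2 - conj w * ζ) * q ζ‖ ^ 2 =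
      (2 - ‖w‖ ^ 2) * ‖(1 - conj w * ζ) ^ 2 * q ζ‖ ^ 2 +
      (1 - ‖w‖ ^ 2) ^ 2 * (‖ζ * (2 - conj w * ζ) * q ζ‖ ^ 2 - (2 - ‖w‖ ^ 2) * ‖q ζ‖ ^ 2) := by
    intro ζ
    apply Complex.ofReal_injective
    push_cast
    have hn : ∀ x : ℂ, ((‖x‖ : ℂ)) ^ 2 = x * conj x := fun x => by
      rw [mul_conj, normSq_eq_norm_sq]; push_cast; rfl
    simp only [hn, map_mul, map_sub, map_pow, conj_conj, map_ofNat, map_one]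
    ring
  have e3 : ∫ ζ, ‖(ζ - w) * (2 - ‖w‖ ^ 2 - conj w * ζ) * q ζ‖ ^ 2 ∂area =
      (2 - ‖w‖ ^ 2) * ∫ ζ, ‖(1 - conj w * ζ) ^ 2 * q ζ‖ ^ 2 ∂area +
      (1 - ‖w‖ ^ 2) ^ 2 * (∫ ζ, ‖ζ * (2 - conj w * ζ) * q ζ‖ ^ 2 ∂area -
        (2 - ‖w‖ ^ 2) * ∫ ζ, ‖q ζ‖ ^ 2 ∂area) := by
    simp only [hid]
    have i1 : Integrable (fun ζ => ‖ζ * (2 - conj w * ζ) * q ζ‖ ^ 2 - (2 - ‖w‖ ^ 2) * ‖q ζ‖ ^ 2)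
        area := (hint m1).sub ((hint m0).const_mul _)
    rw [integral_add ((hint m2).const_mul _) (i1.const_mul _), integral_const_mul,
      integral_const_mul, integral_sub (hint m1) ((hint m0).const_mul _), integral_const_mul]
  simp only [← mul_assoc]
  rw [e3]
  have : 0 ≤ (1 - ‖w‖ ^ 2) ^ 2 * (∫ ζ, ‖ζ * (2 - conj w * ζ) * q ζ‖ ^ 2 ∂area -
        (2 - ‖w‖ ^ 2) * ∫ ζ, ‖q ζ‖ ^ 2 ∂area) := mul_nonneg (sq_nonneg _) (by linarith)
  linarith

lemma eqOn_ball_of_eqOn_ne {f g : ℂ → ℂ} (hf : ContinuousOn f (ball 0 1))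
    (hg : ContinuousOn g (ball 0 1)) (w : ℂ) (h : ∀ ζ ∈ ball (0 : ℂ) 1, ζ ≠ w → f ζ = g ζ) :
    Set.EqOn f g (ball 0 1) := by
  refine eqOn_ball_of_ae_eq_area ?_ hf hg
  have h1 : ∀ᵐ ζ ∂area, ζ ≠ w :=
    ae_area_iff.2 (ae_restrict_of_ae (compl_mem_ae_iff.2 (measure_singleton w)))
  filter_upwards [h1, ae_area_of_forall_mem h] with ζ e1 e2 using e2 e1

/-- The solution of the linear extremal problem has no zeros in the disc besides the prescribed
ones. -/
lemma ne_zero_of_extremal (hz : ∀ n, ‖z n‖ < 1) {e : Fin N → ℕ} {Φ E : ℂ → ℂ} {U : Set ℂ}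
    (hU : IsOpen U) (hUb : closedBall (0 : ℂ) 1 ⊆ U) (hΦ : DifferentiableOn ℂ Φ U)
    (hE : DifferentiableOn ℂ E (ball 0 1))
    (hΦE : Set.EqOn Φ (fun ζ => zeroProd z e ζ * E ζ) (ball 0 1))
    (hrep : ∀ f : ℂ → ℂ, DifferentiableOn ℂ f (ball 0 1) → MemLp f 2 area →
        (∀ n, (e n : ℕ∞) ≤ analyticOrderAt f (z n)) →
        ∫ ζ, f ζ * conj (Φ ζ) ∂area =
          iteratedDeriv (multAtZero z e) f 0 / (multAtZero z e).factorial / (multAtZero z e + 1))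
    (hE0 : E 0 ≠ 0) : ∀ w ∈ ball (0 : ℂ) 1, E w ≠ 0 := by
  intro w hw hEw
  set M := multAtZero z e with hM
  have hΦb : DifferentiableOn ℂ Φ (ball 0 1) := hΦ.mono (ball_subset_closedBall.trans hUb)
  have hw0 : w ≠ 0 := by rintro rfl; exact hE0 hEw
  have hw1 : ‖w‖ < 1 := mem_ball_zero_iff.1 hw
  have hr0 : 0 < ‖w‖ := norm_pos_iff.2 hw0
  have hr2 : ‖w‖ ^ 2 < 1 := pow_lt_one₀ (norm_nonneg _) hw1 two_ne_zero
  have hmem : (0 : ℂ) ∈ ball (0 : ℂ) 1 := mem_ball_self one_pos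
  have hΦw : Φ w = 0 := by rw [hΦE hw]; simp only [hEw, mul_zero]
  obtain ⟨h, hh, hΦh⟩ := exists_eqOn_sub_mul hU hΦ (hUb (ball_subset_closedBall hw)) hΦw
  obtain ⟨E₁, hE₁, hEE₁⟩ := exists_eqOn_sub_mul isOpen_ball hE hw hEw
  have hhE : Set.EqOn h (fun ζ => zeroProd z e ζ * E₁ ζ) (ball 0 1) := by
    refine eqOn_ball_of_eqOn_ne (hh.continuousOn.mono (ball_subset_closedBall.trans hUb))
      ((differentiable_zeroProd z e).continuous.continuousOn.mul hE₁.continuousOn) w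
      fun ζ hζ hne => ?_
    have := hΦE hζ
    simp only [hΦh ζ, hEE₁ ζ] at this
    exact mul_left_cancel₀ (sub_ne_zero.2 hne) (this.trans (by ring))
  set D : ℂ → ℂ := fun ζ => 2 - ‖w‖ ^ 2 - conj w * ζ with hD
  have hDd : Differentiable ℂ D := by fun_prop
  have hDne : ∀ ζ ∈ closedBall (0 : ℂ) 1, D ζ ≠ 0 := by
    intro ζ hζ h0
    have h1 : ((2 - ‖w‖ ^ 2 : ℝ) : ℂ) = conj w * ζ := by
      push_cast; exact sub_eq_zero.1 h0
    have h2 := congrArg norm h1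
    rw [Complex.norm_real, norm_mul, RCLike.norm_conj, Real.norm_of_nonneg (by linarith)] at h2
    have h3 : ‖w‖ * ‖ζ‖ ≤ ‖w‖ := mul_le_of_le_one_right (norm_nonneg _)
      (mem_closedBall_zero_iff.1 hζ)
    linarith
  set V : Set ℂ := U ∩ {ζ | D ζ ≠ 0} with hV
  have hVo : IsOpen V := hU.inter (isOpen_ne.preimage hDd.continuous)
  have hVb : closedBall (0 : ℂ) 1 ⊆ V := fun ζ hζ => ⟨hUb hζ, hDne ζ hζ⟩
  have hq : DifferentiableOn ℂ (fun ζ => h ζ / D ζ) V :=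
    (hh.mono Set.inter_subset_left).div hDd.differentiableOn fun ζ hζ => hζ.2
  have hineq := integral_norm_sq_le_of_mul hVo hVb hq w
  have hΦn : ∫ ζ, ‖(ζ - w) * ((2 - ‖w‖ ^ 2 - conj w * ζ) * (h ζ / D ζ))‖ ^ 2 ∂area =
      ∫ ζ, ‖Φ ζ‖ ^ 2 ∂area := by
    refine integral_congr_ae (ae_area_of_forall_mem fun ζ hζ => ?_)
    change ‖(ζ - w) * (D ζ * (h ζ / D ζ))‖ ^ 2 = _
    rw [mul_div_cancel₀ _ (hDne ζ (ball_subset_closedBall hζ)), ← hΦh ζ]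
  rw [hΦn] at hineq
  -- This is Φ divided by the one-point divisor factor at w. The zero removed is surplus, being a
  -- zero of E, so g keeps all prescribed zeros even if w is one of the z n.
  set g : ℂ → ℂ := fun ζ => (1 - conj w * ζ) ^ 2 * (h ζ / D ζ) with hg
  have hgV : DifferentiableOn ℂ g V := DifferentiableOn.mul (by fun_prop) hq
  have hgb : DifferentiableOn ℂ g (ball 0 1) := hgV.mono (ball_subset_closedBall.trans hVb)
  have hgm : MemLp g 2 area := memLp_area_of_continuousOn_closedBall (hgV.continuousOn.mono hVb) 2
  have hΦm : MemLp Φ 2 area := memLp_area_of_continuousOn_closedBall (hΦ.continuousOn.mono hUb) 2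
  have hE₂ : DifferentiableOn ℂ (fun ζ => (1 - conj w * ζ) ^ 2 * (E₁ ζ / D ζ)) (ball 0 1) :=
    DifferentiableOn.mul (by fun_prop) (hE₁.div hDd.differentiableOn
      fun ζ hζ => hDne ζ (ball_subset_closedBall hζ))
  have hgE : Set.EqOn g (fun ζ => zeroProd z e ζ * ((1 - conj w * ζ) ^ 2 * (E₁ ζ / D ζ)))
      (ball 0 1) := fun ζ hζ => by
    simp only [hg, hhE hζ]; ring
  have hfac : ((M.factorial : ℕ) : ℂ) ≠ 0 := by exact_mod_cast M.factorial_ne_zero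
  have r1 := hrep Φ hΦb hΦm (le_analyticOrderAt_zeroProd_mul hz hE hΦE)
  have r2 := hrep g hgb hgm (le_analyticOrderAt_zeroProd_mul hz hE₂ hgE)
  rw [hM, iteratedDeriv_zeroProd_mul z e hE hΦE, ← hM, mul_div_cancel_left₀ _ hfac] at r1
  rw [hM, iteratedDeriv_zeroProd_mul z e hE₂ hgE, ← hM, mul_div_cancel_left₀ _ hfac] at r2
  have hM1 : (M : ℂ) + 1 ≠ 0 := by exact_mod_cast M.succ_ne_zero
  have hlead := leadCoeff_ne_zero z e
  -- Both pairings are values at 0 of the cofactors, and the divided factor takes the value -w(2 -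
  -- |w|²) there.
  have hr : (∫ ζ, Φ ζ * conj (Φ ζ) ∂area) =
      -(w * ((2 - ‖w‖ ^ 2 : ℝ) : ℂ)) * ∫ ζ, g ζ * conj (Φ ζ) ∂area := by
    have hD0 : ((2 - ‖w‖ ^ 2 : ℝ) : ℂ) = D 0 := by simp [hD]
    have := hDne 0 (ball_subset_closedBall hmem)
    rw [r1, r2, hEE₁ 0, hD0]
    field_simp
    ring
  set t : ℝ := ∫ ζ, ‖Φ ζ‖ ^ 2 ∂area with ht
  have htn : ‖∫ ζ, Φ ζ * conj (Φ ζ) ∂area‖ = t := by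
    rw [integral_mul_conj_self, Complex.norm_real, Real.norm_of_nonneg]
    exact integral_nonneg fun ζ => by positivity
  have ht0 : 0 < t := by
    rw [← htn, r1, norm_pos_iff]
    exact div_ne_zero (mul_ne_zero hlead hE0) hM1
  have hcs := norm_integral_mul_conj_sq_le hgm hΦm
  have hr' := congrArg norm hr
  rw [htn, norm_mul, norm_neg, norm_mul, Complex.norm_real,
    Real.norm_of_nonneg (by linarith : (0 : ℝ) ≤ 2 - ‖w‖ ^ 2)] at hr'
  set I : ℝ := ‖∫ ζ, g ζ * conj (Φ ζ) ∂area‖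
  set G : ℝ := ∫ ζ, ‖g ζ‖ ^ 2 ∂area
  set r : ℝ := ‖w‖
  have hs : 0 < 2 - r ^ 2 := by linarith
  have h1 : t ^ 2 ≤ (r * (2 - r ^ 2)) ^ 2 * (G * t) := by
    calc t ^ 2 = (r * (2 - r ^ 2)) ^ 2 * I ^ 2 := by rw [hr']; ring
      _ ≤ _ := mul_le_mul_of_nonneg_left hcs (by positivity)
  have h2 : (r * (2 - r ^ 2)) ^ 2 * (G * t) ≤ (r ^ 2 * (2 - r ^ 2)) * t * t := by
    calc (r * (2 - r ^ 2)) ^ 2 * (G * t) = (r ^ 2 * (2 - r ^ 2) * t) * ((2 - r ^ 2) * G) := by ring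
      _ ≤ (r ^ 2 * (2 - r ^ 2) * t) * t := mul_le_mul_of_nonneg_left hineq (by positivity)
      _ = _ := by ring
  -- Since r²(2 - r²) = 1 - (1 - r²)², `h1` and `h2` give t² ≤ t² - (1 - r²)² t², which is absurd.
  have h3 : 0 < (1 - r ^ 2) ^ 2 * t ^ 2 := by
    have : 0 < 1 - r ^ 2 := by linarith
    positivity
  nlinarith

/-! ### Comparison of the two extremal problems. -/

lemma eLpNorm_pow_two (f : ℂ → ℂ) {s : ℕ} (hs : s ≠ 0) :
    eLpNorm (fun ζ => f ζ ^ s) 2 area = eLpNorm f ((2 * s : ℕ) : ℝ≥0∞) area ^ s := by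
  have h1 : eLpNorm (fun ζ => f ζ ^ s) 2 area = eLpNorm (fun ζ => ‖f ζ‖ ^ (s : ℝ)) 2 area := by
    refine eLpNorm_congr_norm_ae (Eventually.of_forall fun ζ => ?_)
    rw [Real.rpow_natCast, norm_pow, norm_pow, norm_norm]
  rw [h1, eLpNorm_norm_rpow f (by positivity), ENNReal.rpow_natCast, ENNReal.ofReal_natCast]
  push_cast
  rfl

lemma integral_norm_sq_eq_one_iff {f : ℂ → ℂ} (hf : MemLp f 2 area) :
    ∫ ζ, ‖f ζ‖ ^ 2 ∂area = 1 ↔ eLpNorm f 2 area = 1 := by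
  rw [← norm_toLp_sq hf, pow_eq_one_iff_of_nonneg (norm_nonneg _) two_ne_zero, Lp.norm_toLp,
    ENNReal.toReal_eq_one_iff]

lemma isOpen_setOf_one_sub_conj_mul_ne_zero {N : ℕ} (z : Fin N → ℂ) :
    IsOpen {ζ : ℂ | ∀ n, 1 - conj (z n) * ζ ≠ 0} := by
  simp only [Set.ofPred_forall]
  exact isOpen_iInter_of_finite fun n => isOpen_ne.preimage (by fun_prop)

/-- The power `p / 2` of the canonical divisor is a multiple of the solution of a linear
extremal problem in `A²`. -/
theorem IsCanonicalDivisor.pow_eq (hz : ∀ n, ‖z n‖ < 1) (hinj : Function.Injective z)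
    (d : Fin N → ℕ) {s : ℕ} (hs : s ≠ 0) {G : ℂ → ℂ}
    (hG : IsCanonicalDivisor ((2 * s : ℕ) : ℝ≥0∞) z d G) :
    ∃ (c₀ : ℂ) (c : Fin N → ℕ → ℂ), ∀ ζ ∈ ball (0 : ℂ) 1,
      G ζ ^ s = c₀ * ζ ^ (multAtZero z fun n => s * d n) +
        ∑ n, ∑ j ∈ Finset.range (s * d n), c n j * kernel (z n) j ζ := by
  obtain ⟨x, ⟨⟨⟨hGd, hGm⟩, hGo⟩, hGn, hx, hGx⟩, hmax⟩ := hG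
  set e : Fin N → ℕ := fun n => s * d n with he
  set M := multAtZero z e with hM
  set m := multAtZero z d with hm
  have hmem : (0 : ℂ) ∈ ball (0 : ℂ) 1 := mem_ball_self one_pos
  have hm0 : (0 : ℝ) < m.factorial := by exact_mod_cast m.factorial_pos
  have hmc : ((m.factorial : ℕ) : ℂ) ≠ 0 := by exact_mod_cast m.factorial_ne_zero
  have hMc : ((M.factorial : ℕ) : ℂ) ≠ 0 := by exact_mod_cast M.factorial_ne_zero
  have hM1 : (0 : ℝ) < (M : ℝ) + 1 := by positivity
  have hM1c : (M : ℂ) + 1 ≠ 0 := by exact_mod_cast M.succ_ne_zero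
  obtain ⟨c, hc⟩ := exists_extremal hz e
  obtain ⟨hΦo, hrep⟩ := hc _ rfl
  set Φ : ℂ → ℂ := fun ζ => ζ ^ multAtZero z e -
    ∑ n, ∑ j ∈ Finset.range (e n), c n j * kernel (z n) j ζ with hΦ
  set U : Set ℂ := {ζ : ℂ | ∀ n, 1 - conj (z n) * ζ ≠ 0} with hUdef
  have hU : IsOpen U := isOpen_setOf_one_sub_conj_mul_ne_zero z
  have hUb : closedBall (0 : ℂ) 1 ⊆ U := fun ζ hζ n =>
    one_sub_conj_mul_ne_zero (mul_lt_one_of_nonneg_of_lt_one_left (norm_nonneg _) (hz n)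
      (mem_closedBall_zero_iff.1 hζ))
  have hUk : ∀ n, U ⊆ {ζ | 1 - conj (z n) * ζ ≠ 0} := fun n _ hζ => hζ n
  have hΦU : DifferentiableOn ℂ Φ U :=
    DifferentiableOn.sub (by fun_prop) (DifferentiableOn.fun_sum fun n _ =>
      DifferentiableOn.fun_sum fun j _ => ((differentiableOn_kernel (z n) j).mono
        (hUk n)).const_mul _)
  have hΦb : DifferentiableOn ℂ Φ (ball 0 1) := hΦU.mono (ball_subset_closedBall.trans hUb)
  have hΦm : MemLp Φ 2 area := memLp_area_of_continuousOn_closedBall (hΦU.continuousOn.mono hUb) 2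
  -- representation of functions with the prescribed zeros
  have hrep' : ∀ f g : ℂ → ℂ, DifferentiableOn ℂ g (ball 0 1) → DifferentiableOn ℂ f (ball 0 1) →
      MemLp f 2 area → Set.EqOn f (fun ζ => zeroProd z e ζ * g ζ) (ball 0 1) →
      ∫ ζ, f ζ * conj (Φ ζ) ∂area = leadCoeff z e * g 0 / (M + 1) := by
    intro f g hg hf hfm hfg
    rw [hrep f hf hfm (le_analyticOrderAt_zeroProd_mul hz hg hfg), ← hM, hM,
      iteratedDeriv_zeroProd_mul z e hg hfg, ← hM, mul_div_cancel_left₀ _ hMc]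
  obtain ⟨E, hE, hΦE⟩ := exists_eqOn_zeroProd_mul hz hinj hΦb hΦo
  have hΦΦ := hrep' Φ E hE hΦb hΦm hΦE
  rw [integral_mul_conj_self] at hΦΦ
  set t : ℝ := ∫ ζ, ‖Φ ζ‖ ^ 2 ∂area with ht
  -- The polynomial `zeroProd z e` pairs with Φ to a nonzero number, so Φ cannot vanish identically.
  have ht0 : 0 < t := by
    have hPm : MemLp (zeroProd z e) 2 area := memLp_area_of_continuousOn_closedBall
      (differentiable_zeroProd z e).continuous.continuousOn 2
    have h1 := hrep' (zeroProd z e) (fun _ => 1) (by fun_prop)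
      (differentiable_zeroProd z e).differentiableOn hPm (fun ζ _ => by simp)
    have h2 := norm_integral_mul_conj_sq_le hPm hΦm
    rw [h1] at h2
    have h3 : 0 < ‖leadCoeff z e * 1 / ((M : ℂ) + 1)‖ := norm_pos_iff.2
      (div_ne_zero (mul_ne_zero (leadCoeff_ne_zero z e) one_ne_zero) hM1c)
    refine lt_of_le_of_ne (integral_nonneg fun ζ => by positivity) fun h0 => ?_
    rw [← ht, ← h0, mul_zero] at h2
    exact absurd h2 (not_le.2 (by positivity))
  have htc : (t : ℂ) ≠ 0 := by exact_mod_cast ht0.ne'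
  have hE0 : E 0 ≠ 0 := by
    intro h
    rw [h, mul_zero, zero_div] at hΦΦ
    exact htc hΦΦ
  have hEne := ne_zero_of_extremal hz hU hUb hΦU hE hΦE hrep hE0
  obtain ⟨ε, hε, hεE⟩ := exists_pow_eq_of_ne_zero hE hEne hs
  have hsq : √t ^ 2 = t := Real.sq_sqrt ht0.le
  have hst : 0 < √t := Real.sqrt_pos.2 ht0
  have hstc : ((√t : ℝ) : ℂ) ≠ 0 := by exact_mod_cast hst.ne'
  have hsqc : ((√t : ℝ) : ℂ) ^ 2 = t := by exact_mod_cast hsq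
  -- the competitor
  set α : ℂ := leadCoeff z d * ε 0 with hα
  have hαs : α ^ s = ((M : ℂ) + 1) * t := by
    rw [hα, mul_pow, hεE 0 hmem, ← leadCoeff_mul, hΦΦ]
    field_simp
    rfl
  have hα0 : α ≠ 0 := by
    intro h
    rw [h, zero_pow hs] at hαs
    exact mul_ne_zero hM1c htc hαs.symm
  -- Normalizing H^s = Φ/√t needs μ^s = 1/√t, that is (μα)^s = (M + 1)√t. Taking μα = y, the
  -- positive root, selects the branch for which the derivative of H at 0 is positive.
  set y : ℝ := ((M + 1) * √t) ^ ((s : ℝ)⁻¹) with hy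
  have hy0 : 0 < y := Real.rpow_pos_of_pos (by positivity) _
  have hys : y ^ s = (M + 1) * √t := Real.rpow_inv_natCast_pow (by positivity) hs
  set μ : ℂ := y / α with hμ
  have hμs : μ ^ s = ((√t : ℝ) : ℂ)⁻¹ := by
    have : (y : ℂ) ^ s = (M + 1) * ((√t : ℝ) : ℂ) := by exact_mod_cast hys
    rw [hμ, div_pow, this, hαs, ← hsqc]
    field_simp
  set Ψ : ℂ → ℂ := fun ζ => ((√t : ℝ) : ℂ)⁻¹ * Φ ζ with hΨ
  have hΨm : MemLp Ψ 2 area := hΦm.const_mul _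
  have hΨ1 : ∫ ζ, ‖Ψ ζ‖ ^ 2 ∂area = 1 := by
    simp only [hΨ, norm_mul, mul_pow, norm_inv, Complex.norm_real, inv_pow,
      Real.norm_of_nonneg hst.le, hsq]
    rw [integral_const_mul, ← ht, inv_mul_cancel₀ ht0.ne']
  set H : ℂ → ℂ := fun ζ => zeroProd z d ζ * (μ * ε ζ) with hH
  have hμε : DifferentiableOn ℂ (fun ζ => μ * ε ζ) (ball 0 1) := hε.const_mul μ
  have hHd : DifferentiableOn ℂ H (ball 0 1) :=
    (differentiable_zeroProd z d).differentiableOn.mul hμε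
  have hHs : ∀ ζ ∈ ball (0 : ℂ) 1, H ζ ^ s = Ψ ζ := by
    intro ζ hζ
    simp only [hH, hΨ, mul_pow, hμs, hεE ζ hζ, hΦE hζ, he, zeroProd_mul]
    ring
  have hHn : eLpNorm H ((2 * s : ℕ) : ℝ≥0∞) area = 1 := by
    have h1 : eLpNorm (fun ζ => H ζ ^ s) 2 area = 1 := by
      rw [eLpNorm_congr_ae (ae_area_of_forall_mem hHs)]
      exact (integral_norm_sq_eq_one_iff hΨm).1 hΨ1
    rw [eLpNorm_pow_two H hs] at h1
    exact (ENNReal.pow_right_strictMono hs).injective (h1.trans (one_pow s).symm)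
  have hadm : IsAdmissible ((2 * s : ℕ) : ℝ≥0∞) z d H (m.factorial * y) := by
    refine ⟨⟨⟨hHd, aestronglyMeasurable_area hHd.continuousOn, by rw [hHn]; simp⟩,
      le_analyticOrderAt_zeroProd_mul hz hμε fun ζ _ => rfl⟩, hHn, by positivity, ?_⟩
    rw [iteratedDeriv_zeroProd_mul z d hμε fun ζ _ => rfl, ← hm]
    push_cast
    have : leadCoeff z d * (μ * ε 0) = y := by
      rw [mul_left_comm, ← hα, hμ, div_mul_cancel₀ _ hα0]
    rw [this]
  have hyx : y ≤ x / m.factorial := by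
    rw [le_div_iff₀ hm0, mul_comm]
    exact hmax H _ hadm
  -- comparison with the power of the canonical divisor
  obtain ⟨g, hg, hGg⟩ := exists_eqOn_zeroProd_mul hz hinj hGd hGo
  have hFd : DifferentiableOn ℂ (fun ζ => G ζ ^ s) (ball 0 1) := hGd.fun_pow s
  have hFn : eLpNorm (fun ζ => G ζ ^ s) 2 area = 1 := by
    rw [eLpNorm_pow_two G hs, hGn, one_pow]
  have hFm : MemLp (fun ζ => G ζ ^ s) 2 area :=
    ⟨aestronglyMeasurable_area hFd.continuousOn, by rw [hFn]; simp⟩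
  have hF1 := (integral_norm_sq_eq_one_iff hFm).2 hFn
  have hFΦ := hrep' (fun ζ => G ζ ^ s) (fun ζ => g ζ ^ s) (hg.fun_pow s) hFd hFm fun ζ hζ => by
    simp only [hGg hζ, mul_pow, he, zeroProd_mul]
  have hlg : leadCoeff z d * g 0 = ((x / m.factorial : ℝ) : ℂ) := by
    rw [iteratedDeriv_zeroProd_mul z d hg hGg, ← hm] at hGx
    push_cast
    rw [← hGx, mul_div_cancel_left₀ _ hmc]
  have hX : ∫ ζ, G ζ ^ s * conj (Φ ζ) ∂area = (((x / m.factorial) ^ s / (M + 1) : ℝ) : ℂ) := by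
    rw [hFΦ, he, leadCoeff_mul, ← mul_pow, hlg]
    push_cast; rfl
  set X : ℝ := (x / m.factorial) ^ s / (M + 1) with hXdef
  have hX0 : 0 ≤ X := by positivity
  -- Extremality of G against H gives this lower bound; Cauchy–Schwarz gives the matching upper
  -- bound `hX2`.
  have hX1 : √t ≤ X := by
    rw [hXdef, le_div_iff₀ hM1, mul_comm, ← hys]
    exact pow_le_pow_left₀ hy0.le hyx s
  have hX2 : X ≤ √t := by
    have h1 := norm_integral_mul_conj_sq_le hFm hΦm
    rw [hX, hF1, one_mul, Complex.norm_real, Real.norm_of_nonneg hX0] at h1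
    exact Real.le_sqrt_of_sq_le h1
  have hXt : X = √t := le_antisymm hX2 hX1
  have hFΨ : ∫ ζ, G ζ ^ s * conj (Ψ ζ) ∂area = 1 := by
    have h1 : ∀ ζ, G ζ ^ s * conj (Ψ ζ) = ((√t : ℝ) : ℂ)⁻¹ * (G ζ ^ s * conj (Φ ζ)) := fun ζ => by
      simp only [hΨ, map_mul, map_inv₀, conj_ofReal]; ring
    simp only [h1]
    rw [integral_const_mul, hX, hXt, inv_mul_cancel₀ hstc]
  have hFeq := eqOn_ball_of_ae_eq_area (ae_eq_of_integral_mul_conj_eq_one hFm hΨm hF1 hΨ1 hFΨ)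
    hFd.continuousOn (hΦb.continuousOn.const_smul (((√t : ℝ) : ℂ)⁻¹))
  refine ⟨((√t : ℝ) : ℂ)⁻¹, fun n j => -(((√t : ℝ) : ℂ)⁻¹ * c n j), fun ζ hζ => ?_⟩
  refine (hFeq hζ).trans ?_
  simp only [hΨ, hΦ, mul_sub, neg_mul, Finset.sum_neg_distrib, ← sub_eq_add_neg, Finset.mul_sum,
    mul_assoc]
  rfl

/-! ### From kernels to partial fractions. -/

/-- With u = 1 - w̄ζ, expand ζ^k = w̄^{-k}(1 - u)^k and divide by u^{k+2}. The numerator has degree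
k in u, so no exponent below 2 occurs. -/
lemma kernel_eq_sum {w ζ : ℂ} (hw : w ≠ 0) (h : 1 - conj w * ζ ≠ 0) (k : ℕ) :
    kernel w k ζ = ∑ j ∈ Finset.range (k + 1),
      ((conj w ^ k)⁻¹ * (-1) ^ (k - j) * k.choose j) / (1 - conj w * ζ) ^ (j + 2) := by
  have hw' : conj w ≠ 0 := (map_ne_zero _).2 hw
  have h1 : ζ ^ k = (conj w ^ k)⁻¹ * (1 + -(1 - conj w * ζ)) ^ k := by
    rw [eq_inv_mul_iff_mul_eq₀ (pow_ne_zero k hw'), ← mul_pow]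
    congr 1; ring
  rw [kernel, h1, add_pow, Finset.mul_sum, Finset.sum_div]
  refine Finset.sum_congr rfl fun j hj => ?_
  have hj' : k + 2 = (k - j) + (j + 2) := by
    have := Finset.mem_range.1 hj; omega
  rw [hj', pow_add, neg_pow (1 - conj w * ζ), one_pow,
    div_eq_div_iff (mul_ne_zero (pow_ne_zero _ h) (pow_ne_zero _ h)) (pow_ne_zero _ h)]
  ring

lemma exists_sum_kernel_eq {w : ℂ} (hw : w ≠ 0) (c : ℕ → ℂ) (k : ℕ) :
    ∃ b : ℕ → ℂ, ∀ ζ : ℂ, 1 - conj w * ζ ≠ 0 →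
      ∑ j ∈ Finset.range k, c j * kernel w j ζ =
        ∑ j ∈ Finset.range k, b j / (1 - conj w * ζ) ^ (j + 2) := by
  induction k with
  | zero => exact ⟨0, by simp⟩
  | succ k ih =>
    obtain ⟨b, hb⟩ := ih
    refine ⟨fun j => (if j < k then b j else 0) +
      c k * ((conj w ^ k)⁻¹ * (-1) ^ (k - j) * k.choose j), fun ζ hζ => ?_⟩
    simp only [add_div, Finset.sum_add_distrib]
    rw [Finset.sum_range_succ, hb ζ hζ, kernel_eq_sum hw hζ, Finset.mul_sum]
    congr 1
    · rw [Finset.sum_range_succ, if_neg (lt_irrefl k), zero_div, add_zero]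
      exact Finset.sum_congr rfl fun j hj => by rw [if_pos (Finset.mem_range.1 hj)]
    · exact Finset.sum_congr rfl fun j _ => by ring

/-! ### Rational functions and vanishing residues. -/

/-- The functions which agree with a rational function on a set containing none of its poles. -/
def IsRationalOn (U : Set ℂ) (f : ℂ → ℂ) : Prop :=
  ∃ R : RatFunc ℂ, ∀ ζ ∈ U, R.denom.eval ζ ≠ 0 ∧ f ζ = R.eval (RingHom.id ℂ) ζ

lemma isRationalOn_polynomial (U : Set ℂ) (A : Polynomial ℂ) :
    IsRationalOn U fun ζ => A.eval ζ :=
  ⟨algebraMap (Polynomial ℂ) (RatFunc ℂ) A, fun ζ _ => by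
    rw [RatFunc.denom_algebraMap, RatFunc.eval_algebraMap]
    simp [Polynomial.eval₂_id]⟩

lemma eval₂_id_denom_ne_zero {R : RatFunc ℂ} {ζ : ℂ} (h : R.denom.eval ζ ≠ 0) :
    R.denom.eval₂ (RingHom.id ℂ) ζ ≠ 0 := by
  rwa [Polynomial.eval₂_id]

lemma IsRationalOn.add {U : Set ℂ} {f g : ℂ → ℂ} (hf : IsRationalOn U f)
    (hg : IsRationalOn U g) : IsRationalOn U fun ζ => f ζ + g ζ := by
  obtain ⟨R, hR⟩ := hf
  obtain ⟨S, hS⟩ := hg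
  refine ⟨R + S, fun ζ hζ => ⟨fun h0 => ?_, ?_⟩⟩
  · have := Polynomial.eval_eq_zero_of_dvd_of_eval_eq_zero (RatFunc.denom_add_dvd R S) h0
    rw [Polynomial.eval_mul] at this
    exact mul_ne_zero (hR ζ hζ).1 (hS ζ hζ).1 this
  · rw [RatFunc.eval_add (RingHom.id ℂ) ζ (eval₂_id_denom_ne_zero (hR ζ hζ).1)
      (eval₂_id_denom_ne_zero (hS ζ hζ).1), ← (hR ζ hζ).2, ← (hS ζ hζ).2]

lemma IsRationalOn.sum {U : Set ℂ} {ι : Type*} (s : Finset ι) {f : ι → ℂ → ℂ}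
    (hf : ∀ i ∈ s, IsRationalOn U (f i)) : IsRationalOn U fun ζ => ∑ i ∈ s, f i ζ := by
  classical
  induction s using Finset.induction_on with
  | empty => simpa using isRationalOn_polynomial U 0
  | insert a s ha ih =>
    simp only [Finset.sum_insert ha]
    exact (hf a (Finset.mem_insert_self a s)).add
      (ih fun i hi => hf i (Finset.mem_insert_of_mem hi))

lemma isRationalOn_div_pow {U : Set ℂ} {a : ℂ} (hU : ∀ ζ ∈ U, 1 - a * ζ ≠ 0) (c : ℂ) (k : ℕ) :
    IsRationalOn U fun ζ => c / (1 - a * ζ) ^ k := by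
  set q : Polynomial ℂ := (1 - Polynomial.C a * Polynomial.X) ^ k with hq
  have hqe : ∀ ζ, q.eval ζ = (1 - a * ζ) ^ k := fun ζ => by simp [hq]
  by_cases hq0 : q = 0
  · refine ⟨0, fun ζ hζ => absurd (hqe ζ) ?_⟩
    rw [hq0, Polynomial.eval_zero]
    exact (pow_ne_zero k (hU ζ hζ)).symm
  set R : RatFunc ℂ := algebraMap (Polynomial ℂ) (RatFunc ℂ) (Polynomial.C c) /
    algebraMap (Polynomial ℂ) (RatFunc ℂ) q with hR
  have hden : ∀ ζ ∈ U, R.denom.eval ζ ≠ 0 := fun ζ hζ h0 => pow_ne_zero k (hU ζ hζ) (by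
    rw [← hqe]
    exact Polynomial.eval_eq_zero_of_dvd_of_eval_eq_zero (RatFunc.denom_div_dvd _ _) h0)
  refine ⟨R, fun ζ hζ => ⟨hden ζ hζ, ?_⟩⟩
  have h1 : R * algebraMap (Polynomial ℂ) (RatFunc ℂ) q =
      algebraMap (Polynomial ℂ) (RatFunc ℂ) (Polynomial.C c) :=
    div_mul_cancel₀ _ (RatFunc.algebraMap_ne_zero hq0)
  have h2 := congrArg (RatFunc.eval (RingHom.id ℂ) ζ) h1
  rw [RatFunc.eval_mul (RingHom.id ℂ) ζ (eval₂_id_denom_ne_zero (hden ζ hζ))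
    (by rw [RatFunc.denom_algebraMap]; simp), RatFunc.eval_algebraMap, RatFunc.eval_algebraMap] at h2
  simp only [Algebra.algebraMap_self, RingHom.id_apply, Polynomial.eval₂_id, Polynomial.eval_C,
    hqe] at h2
  rw [div_eq_iff (pow_ne_zero k (hU ζ hζ)), h2]

/-- Exponents of at least 2 have a power as primitive; no logarithm arises. -/
lemma hasDerivAt_div_pow {a ζ : ℂ} (ha : a ≠ 0) (h : 1 - a * ζ ≠ 0) (c : ℂ) (j : ℕ) :
    HasDerivAt (fun ζ => c / ((j + 1) * a) * ((1 - a * ζ) ^ (j + 1))⁻¹)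
      (c / (1 - a * ζ) ^ (j + 2)) ζ := by
  have h1 : HasDerivAt (fun ζ => 1 - a * ζ) (-a) ζ := by
    simpa using ((hasDerivAt_id ζ).const_mul a).const_sub 1
  have h2 := ((h1.fun_pow (j + 1)).fun_inv (pow_ne_zero _ h)).const_mul (c / ((j + 1) * a))
  refine h2.congr_deriv ?_
  have hj : (j : ℂ) + 1 ≠ 0 := by exact_mod_cast j.succ_ne_zero
  simp only [Nat.add_sub_cancel]
  push_cast
  field_simp
  ring

lemma eventually_one_sub_mul_ne_zero (a : Fin N → ℂ) (w : ℂ) :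
    ∀ᶠ ζ in 𝓝[≠] w, ∀ n, 1 - a n * ζ ≠ 0 := by
  refine eventually_all.2 fun n => ?_
  by_cases h : 1 - a n * w = 0
  · filter_upwards [self_mem_nhdsWithin] with ζ hζ h0
    have ha : a n ≠ 0 := by intro h'; simp [h'] at h
    have : a n * ζ = a n * w := by linear_combination h - h0
    exact hζ (mul_left_cancel₀ ha this)
  · have hc : Continuous fun ζ => 1 - a n * ζ := by fun_prop
    exact nhdsWithin_le_nhds (hc.continuousAt.eventually_ne h)

/-- A single-valued primitive on a punctured neighbourhood kills the integral over each small
circle. -/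
lemma hasResidue_zero_of_hasDerivAt {f F : ℂ → ℂ} {w : ℂ}
    (h : ∀ᶠ ζ in 𝓝[≠] w, HasDerivAt F (f ζ) ζ) : HasResidue f w 0 := by
  obtain ⟨ε, hε, hεU⟩ := Metric.mem_nhdsWithin_iff.1 h
  filter_upwards [Ioo_mem_nhdsGT hε] with r hr
  rw [circleIntegral.integral_eq_zero_of_hasDerivWithinAt (f := F) hr.1.le, mul_zero]
  intro ζ hζ
  have hζr : dist ζ w = r := hζ
  have hm : ζ ∈ ball w ε ∩ {w}ᶜ := by
    refine ⟨by rw [mem_ball, hζr]; exact hr.2, fun h' => ?_⟩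
    rw [Set.mem_singleton_iff.1 h', dist_self] at hζr
    exact hr.1.ne hζr
  exact HasDerivAt.hasDerivWithinAt (hεU hm)

/-- A function with an expansion in negative powers of order at least two is rational with
vanishing residues. -/
lemma exists_ratFunc (a : Fin N → ℂ) (S : Finset (Fin N)) (hS : ∀ n ∈ S, a n ≠ 0)
    (A : Polynomial ℂ) (e : Fin N → ℕ) (c : Fin N → ℕ → ℂ) :
    ∃ R : RatFunc ℂ, (∀ ζ, (∀ n, 1 - a n * ζ ≠ 0) → R.denom.eval ζ ≠ 0 ∧
      A.eval ζ + ∑ n ∈ S, ∑ j ∈ Finset.range (e n), c n j / (1 - a n * ζ) ^ (j + 2) =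
        R.eval (RingHom.id ℂ) ζ) ∧
      ∀ w, HasResidue (fun ζ => R.eval (RingHom.id ℂ) ζ) w 0 := by
  obtain ⟨R, hR⟩ := (isRationalOn_polynomial {ζ : ℂ | ∀ n, 1 - a n * ζ ≠ 0} A).add
    (IsRationalOn.sum S fun n _ => IsRationalOn.sum (Finset.range (e n)) fun j _ =>
      isRationalOn_div_pow (U := {ζ : ℂ | ∀ n, 1 - a n * ζ ≠ 0}) (fun ζ hζ => hζ n) (c n j) (j + 2))
  refine ⟨R, hR, fun w => ?_⟩
  obtain ⟨F, hF⟩ := (by fun_prop : Differentiable ℂ fun ζ => A.eval ζ).isExactOn_univ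
  refine hasResidue_zero_of_hasDerivAt (F := fun ζ => F ζ + ∑ n ∈ S, ∑ j ∈ Finset.range (e n),
    c n j / ((j + 1) * a n) * ((1 - a n * ζ) ^ (j + 1))⁻¹) ?_
  filter_upwards [eventually_one_sub_mul_ne_zero a w] with ζ hζ
  rw [← (hR ζ hζ).2]
  exact (hF ζ (Set.mem_univ ζ)).fun_add (HasDerivAt.fun_sum fun n hn => HasDerivAt.fun_sum
    fun j _ => hasDerivAt_div_pow (hS n hn) (hζ n) (c n j) j)

end Bergman

end

/-! ### The three assertions. -/

theorem mainTheorem4 (p : ℕ) (hp : Even p) (hp0 : 0 < p) (N : ℕ)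
    (z : Fin N → ℂ) (hz : ∀ n, ‖z n‖ < 1) (hinj : Function.Injective z)
    (d : Fin N → ℕ) (hd : ∀ n, 1 ≤ d n)
    (G : ℂ → ℂ) (hG : Bergman.IsCanonicalDivisor (p : ℝ≥0∞) z d G) :
    ((∀ n, z n ≠ 0) →
      ∃ (c₀ : ℂ) (c : Fin N → ℕ → ℂ), ∀ ζ : ℂ, ‖ζ‖ < 1 →
        G ζ ^ (p / 2) = c₀ + ∑ n, ∑ j ∈ Finset.range (p / 2 * d n),
          c n j / (1 - (starRingEnd ℂ) (z n) * ζ) ^ (j + 2)) ∧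
    (∀ n₀ : Fin N, z n₀ = 0 →
      ∃ (c₀ : ℂ) (c : Fin N → ℕ → ℂ), ∀ ζ : ℂ, ‖ζ‖ < 1 →
        G ζ ^ (p / 2) = c₀ * ζ ^ (p / 2 * d n₀)
          + ∑ j ∈ Finset.range (p / 2 * d n₀), c n₀ j * ζ ^ j
          + ∑ n ∈ Finset.univ.erase n₀, ∑ j ∈ Finset.range (p / 2 * d n),
              c n j / (1 - (starRingEnd ℂ) (z n) * ζ) ^ (j + 2)) ∧
    (∃ R : RatFunc ℂ,
      (∀ ζ : ℂ, ‖ζ‖ < 1 →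
        R.denom.eval ζ ≠ 0 ∧ G ζ ^ (p / 2) = R.eval (RingHom.id ℂ) ζ) ∧
      ∀ w : ℂ, R.denom.eval w = 0 →
        Bergman.HasResidue (fun ζ => R.eval (RingHom.id ℂ) ζ) w 0) := by
  open Bergman in
  obtain ⟨s, hs⟩ := hp
  have hps : p / 2 = s := by omega
  have hs0 : s ≠ 0 := by omega
  obtain rfl : p = 2 * s := by omega
  rw [hps]
  have hden : ∀ ζ : ℂ, ‖ζ‖ < 1 → ∀ n, 1 - (starRingEnd ℂ) (z n) * ζ ≠ 0 := fun ζ hζ n =>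
    one_sub_conj_mul_ne_zero (mul_lt_one_of_nonneg_of_lt_one_left (norm_nonneg _) (hz n) hζ.le)
  obtain ⟨c₀, c, hc⟩ := hG.pow_eq hz hinj d hs0
  have hb : ∀ n, ∃ b : ℕ → ℂ, z n ≠ 0 → ∀ ζ : ℂ, ‖ζ‖ < 1 →
      ∑ j ∈ Finset.range (s * d n), c n j * kernel (z n) j ζ =
        ∑ j ∈ Finset.range (s * d n), b j / (1 - (starRingEnd ℂ) (z n) * ζ) ^ (j + 2) := by
    intro n
    by_cases h : z n = 0
    · exact ⟨0, fun h' => absurd h h'⟩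
    · obtain ⟨b, hb⟩ := exists_sum_kernel_eq h (c n) (s * d n)
      exact ⟨b, fun _ ζ hζ => hb ζ (hden ζ hζ n)⟩
  choose b hb using hb
  have h1 : (∀ n, z n ≠ 0) → ∀ ζ : ℂ, ‖ζ‖ < 1 →
      G ζ ^ s = c₀ + ∑ n, ∑ j ∈ Finset.range (s * d n),
        b n j / (1 - (starRingEnd ℂ) (z n) * ζ) ^ (j + 2) := by
    intro hne ζ hζ
    have hM : multAtZero z (fun n => s * d n) = 0 :=
      Finset.sum_eq_zero fun n _ => if_neg (hne n)
    rw [hc ζ (mem_ball_zero_iff.2 hζ), hM, pow_zero, mul_one]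
    exact congrArg _ (Finset.sum_congr rfl fun n _ => hb n (hne n) ζ hζ)
  have hne : ∀ n₀, z n₀ = 0 → ∀ n ∈ Finset.univ.erase n₀, z n ≠ 0 := fun n₀ h0 n hn h =>
    (Finset.ne_of_mem_erase hn) (hinj (h.trans h0.symm))
  have h2 : ∀ n₀ : Fin N, z n₀ = 0 → ∀ ζ : ℂ, ‖ζ‖ < 1 →
      G ζ ^ s = c₀ * ζ ^ (s * d n₀) + ∑ j ∈ Finset.range (s * d n₀), c n₀ j * ζ ^ j
        + ∑ n ∈ Finset.univ.erase n₀, ∑ j ∈ Finset.range (s * d n),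
          b n j / (1 - (starRingEnd ℂ) (z n) * ζ) ^ (j + 2) := by
    intro n₀ h0 ζ hζ
    have hM : multAtZero z (fun n => s * d n) = s * d n₀ := by
      rw [multAtZero, Finset.sum_eq_single n₀ (fun n _ hn => if_neg
        (hne n₀ h0 n (Finset.mem_erase.2 ⟨hn, Finset.mem_univ n⟩))) (by simp), if_pos h0]
    rw [hc ζ (mem_ball_zero_iff.2 hζ), hM, ← Finset.add_sum_erase _ _ (Finset.mem_univ n₀),
      ← add_assoc]
    congr 1
    -- At the point 0 the kernels are the monomials ζ^j, which produce the polynomial part.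
    · simp [h0, kernel]
    · exact Finset.sum_congr rfl fun n hn => hb n (hne n₀ h0 n hn) ζ hζ
  refine ⟨fun h => ⟨c₀, b, h1 h⟩, fun n₀ h0 => ⟨c₀, fun n => if n = n₀ then c n else b n,
    fun ζ hζ => ?_⟩, ?_⟩
  · rw [h2 n₀ h0 ζ hζ]
    simp only [if_true]
    congr 1
    exact Finset.sum_congr rfl fun n hn => by rw [if_neg (Finset.ne_of_mem_erase hn)]
  · by_cases h : ∀ n, z n ≠ 0
    · obtain ⟨R, hR, hres⟩ := exists_ratFunc (fun n => (starRingEnd ℂ) (z n)) Finset.univ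
        (fun n _ => (map_ne_zero _).2 (h n)) (Polynomial.C c₀) (fun n => s * d n) b
      refine ⟨R, fun ζ hζ => ⟨(hR ζ (hden ζ hζ)).1, ?_⟩, fun w _ => hres w⟩
      rw [← (hR ζ (hden ζ hζ)).2, h1 h ζ hζ, Polynomial.eval_C]
    · push Not at h
      obtain ⟨n₀, h0⟩ := h
      obtain ⟨R, hR, hres⟩ := exists_ratFunc (fun n => (starRingEnd ℂ) (z n))
        (Finset.univ.erase n₀) (fun n hn => (map_ne_zero _).2 (hne n₀ h0 n hn))
        (Polynomial.C c₀ * Polynomial.X ^ (s * d n₀) +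
          ∑ j ∈ Finset.range (s * d n₀), Polynomial.C (c n₀ j) * Polynomial.X ^ j)
        (fun n => s * d n) b
      refine ⟨R, fun ζ hζ => ⟨(hR ζ (hden ζ hζ)).1, ?_⟩, fun w _ => hres w⟩
      rw [← (hR ζ (hden ζ hζ)).2, h2 n₀ h0 ζ hζ]
      simp [Polynomial.eval_finsetSum]
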